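/- Let $\mathfrak h$ be a complex Hilbert space, let $L_1,\dots,L_n$ be bounded operators on $\mathfrak h$, let $H$ be a bounded self-adjoint operator on $\mathfrak h$, write $G=(\mathbf L,H)$, and let $\Theta=(\theta_1,\dots,\theta_n)\in\mathbb R^n$ be quadrature phases. Put $$K=-\tfrac12\sum_{k=1}^n L_k^*L_k-iH,\qquad K(G,\Theta)=-\tfrac12\sum_{k=1}^n\bigl(L_k^*L_k+e^{2i\theta_k}L_k^2\bigr)-iH .$$ Suppose that all $n$ output channels are measured (complete homodyne detection). The measured quadratures are realized on a filtered probability space as adapted real processes $Y_1,\dots,Y_n$ with $Y_k(0)=0$ and $dY_k=dW_k+a_k\,dt$, where $W=(W_1,\dots,W_n)$ is a standard $n$-dimensional Brownian motion relative to the filtration and the drifts $a_k$ have almost surely locally integrable paths; in particular $dY_j\,dY_k=\delta_{jk}\,dt$. Let $\psi\in\mathfrak h$, and let $\chi_t$ be an $\mathfrak h$-valued process. Then the pure-state Belavkin–Zakai equation for the unnormalized conditional vector, $$d\chi_t=K\chi_t\,dt+\sum_{k=1}^n e^{i\theta_k}L_k\chi_t\,dY_k(t)\quad\text{(Itô)},\qquad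 \chi_0=\psi,$$ has the Stratonovich form $$d\chi_t=\Bigl(K(G,\Theta)\,dt+\sum_{k=1}^n e^{i\theta_k}L_k\,dY_k(t)\Bigr)\circ\chi_t,\qquad \chi_0=\psi ,$$ that is, $d\chi_t=K(G,\Theta)\chi_t\,dt+\sum_{k}\bigl(e^{i\theta_k}L_k\chi_t\bigr)\circ dY_k(t)$, where $X\circ dY=X\,dY+\tfrac12\,dX\,dY$: an adapted process $\chi$ with almost surely continuous paths solves the Itô equation if and only if it solves the Stratonovich equation (the covariations $[e^{i\theta_k}L_k\chi,Y_k]$ in the latter being required to exist as continuous processes of locally bounded variation). -/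

import Mathlib

open MeasureTheory ProbabilityTheory Filter Topology
open scoped NNReal ENNReal

noncomputable section

/-! ### Riemann sums, Itô integral, covariation, Stratonovich integral -/

/-- A finite partition `0 = pt 0 ≤ pt 1 ≤ ⋯ ≤ pt N = t` of the interval `[0, t]`. -/
structure TimePartition (t : ℝ≥0) where
  N : ℕ
  pt : ℕ → ℝ≥0
  mono : Monotone pt
  pt_zero : pt 0 = 0
  pt_last : pt N = t

/-- The mesh `max_i (pt (i + 1) - pt i)`. -/
def TimePartition.mesh {t : ℝ≥0} (p : TimePartition t) : ℝ≥0 :=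
  (Finset.range p.N).sup fun i => p.pt (i + 1) - p.pt i

/-- "The mesh of the partition of `[0, t]` tends to zero". -/
def meshToZero (t : ℝ≥0) : Filter (TimePartition t) :=
  Filter.comap TimePartition.mesh (𝓝 0)

section Integrals

variable {Ω E : Type*} {mΩ : MeasurableSpace Ω} [NormedAddCommGroup E] [NormedSpace ℝ E]

/-- The left-point sum `∑ X(tᵢ) (Y(tᵢ₊₁) - Y(tᵢ))`. -/
def leftSum (X : ℝ≥0 → Ω → E) (Y : ℝ≥0 → Ω → ℝ) {t : ℝ≥0} (p : TimePartition t) (ω : Ω) : E :=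
  ∑ i ∈ Finset.range p.N, (Y (p.pt (i + 1)) ω - Y (p.pt i) ω) • X (p.pt i) ω

/-- The sum of products of increments `∑ (X(tᵢ₊₁) - X(tᵢ)) (Y(tᵢ₊₁) - Y(tᵢ))`. -/
def crossSum (X : ℝ≥0 → Ω → E) (Y : ℝ≥0 → Ω → ℝ) {t : ℝ≥0} (p : TimePartition t) (ω : Ω) : E :=
  ∑ i ∈ Finset.range p.N,
    (Y (p.pt (i + 1)) ω - Y (p.pt i) ω) • (X (p.pt (i + 1)) ω - X (p.pt i) ω)

/-- `I = ∫ X dY` in the sense of Itô, for a process `X` with continuous paths and a continuous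
real semimartingale `Y`: `I` has continuous paths and `I t` is, for every `t`, the limit in
probability of the left-point sums as the mesh tends to zero. -/
structure IsItoIntegral (P : Measure Ω) (X : ℝ≥0 → Ω → E) (Y : ℝ≥0 → Ω → ℝ)
    (I : ℝ≥0 → Ω → E) : Prop where
  continuous : ∀ᵐ ω ∂P, Continuous fun t => I t ω
  tendsto : ∀ t, TendstoInMeasure P (leftSum X Y) (meshToZero t) (I t)

/-- `C = [X, Y]`, i.e. `dC = dX dY`: `C` has continuous paths of locally bounded variation and
`C t` is, for every `t`, the limit in probability of the sums of products of increments. -/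
structure IsCovariation (P : Measure Ω) (X : ℝ≥0 → Ω → E) (Y : ℝ≥0 → Ω → ℝ)
    (C : ℝ≥0 → Ω → E) : Prop where
  continuous : ∀ᵐ ω ∂P, Continuous fun t => C t ω
  boundedVariation : ∀ᵐ ω ∂P, LocallyBoundedVariationOn (fun t => C t ω) Set.univ
  tendsto : ∀ t, TendstoInMeasure P (crossSum X Y) (meshToZero t) (C t)

/-- `S = ∫ X ∘ dY` in the sense of Stratonovich: `X ∘ dY = X dY + ½ dX dY`. -/
def IsStratonovichIntegral (P : Measure Ω) (X : ℝ≥0 → Ω → E) (Y : ℝ≥0 → Ω → ℝ)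
    (S : ℝ≥0 → Ω → E) : Prop :=
  ∃ I C : ℝ≥0 → Ω → E, IsItoIntegral P X Y I ∧ IsCovariation P X Y C ∧
    ∀ᵐ ω ∂P, ∀ t, S t ω = I t ω + (1 / 2 : ℝ) • C t ω

end Integrals

/-! ### The measured quadratures -/

section Record

variable {Ω : Type*} {mΩ : MeasurableSpace Ω} {n : ℕ}

/-- `W` is a standard `n`-dimensional Brownian motion relative to the filtration `F`. -/
structure IsBrownianFamily (F : Filtration ℝ≥0 mΩ) (P : Measure Ω)
    (W : Fin n → ℝ≥0 → Ω → ℝ) : Prop where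
  adapted : ∀ k, StronglyAdapted F (W k)
  isBrownian : ∀ k, IsBrownianReal (W k) P
  indep_components : iIndepFun (fun k ω t => W k t ω) P
  indep_past : ∀ s t : ℝ≥0, s ≤ t →
    Indep (F s) (MeasurableSpace.comap (fun ω k => W k t ω - W k s ω) MeasurableSpace.pi) P

/-- The family of simultaneously measured quadratures, as real processes on a classical
probability space: `Y_k` is adapted and `dY_k = dW_k + a_k dt`, `Y_k(0) = 0`, with independent
Wiener noises `W_k` and a locally integrable drift `a_k`. In particular `dY_j dY_k = δ_{jk} dt`.
The drift is arbitrary, so that this covers the physical law of the output, where `W` is the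
innovation process and `a_k(t) = π_t(e^{iθ_k} L_k + e^{-iθ_k} L_k^*)`, and also the reference law,
under which `a = 0`. The integrated drift is `Y_k - W_k`, hence it is adapted. -/
def IsHomodyneRecord (F : Filtration ℝ≥0 mΩ) (P : Measure Ω) (Y : Fin n → ℝ≥0 → Ω → ℝ) : Prop :=
  (∀ k, StronglyAdapted F (Y k)) ∧
  ∃ (W : Fin n → ℝ≥0 → Ω → ℝ) (a : Fin n → ℝ → Ω → ℝ),
    IsBrownianFamily F P W ∧
    ∀ k, ∀ᵐ ω ∂P, ∀ t : ℝ≥0, IntervalIntegrable (fun s => a k s ω) volume 0 t ∧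
      Y k t ω = W k t ω + ∫ s in (0 : ℝ)..t, a k s ω

end Record

/-! ### Open quantum systems and the pure-state filter -/

/-- The coupling operators `G = (L, H)`: bounded operators `L_1, …, L_n` and a bounded
self-adjoint Hamiltonian on the Hilbert space `𝔥`. -/
structure OpenSystem (n : ℕ) (𝔥 : Type*) [NormedAddCommGroup 𝔥] [InnerProductSpace ℂ 𝔥]
    [CompleteSpace 𝔥] where
  L : Fin n → 𝔥 →L[ℂ] 𝔥
  H : 𝔥 →L[ℂ] 𝔥
  selfAdjoint : IsSelfAdjoint H

namespace OpenSystem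

variable {n : ℕ} {𝔥 : Type*} [NormedAddCommGroup 𝔥] [InnerProductSpace ℂ 𝔥] [CompleteSpace 𝔥]

/-- `K = -½ ∑ L_k^* L_k - i H`. -/
def K (G : OpenSystem n 𝔥) : 𝔥 →L[ℂ] 𝔥 :=
  -((1 / 2 : ℂ) • ∑ k, star (G.L k) * G.L k) - Complex.I • G.H

/-- The measured coupling operator `e^{iθ_k} L_k`. -/
def M (G : OpenSystem n 𝔥) (θ : Fin n → ℝ) (k : Fin n) : 𝔥 →L[ℂ] 𝔥 :=
  Complex.exp (Complex.I * (θ k : ℂ)) • G.L k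

/-- `K(G, Θ) = -½ ∑ (L_k^* L_k + e^{2iθ_k} L_k²) - i H`. -/
def KΘ (G : OpenSystem n 𝔥) (θ : Fin n → ℝ) : 𝔥 →L[ℂ] 𝔥 :=
  -((1 / 2 : ℂ) • ∑ k, (star (G.L k) * G.L k
    + Complex.exp (2 * Complex.I * (θ k : ℂ)) • (G.L k * G.L k))) - Complex.I • G.H

/-- The super-operator `ζ_A(X) = X A + A^* X`. -/
def zeta (A X : 𝔥 →L[ℂ] 𝔥) : 𝔥 →L[ℂ] 𝔥 := X * A + star A * X

/-- The Lindblad generator `𝓛_G`. -/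
def lindbladian (G : OpenSystem n 𝔥) (X : 𝔥 →L[ℂ] 𝔥) : 𝔥 →L[ℂ] 𝔥 :=
  ∑ k, (star (G.L k) * X * G.L k - (1 / 2 : ℂ) • (star (G.L k) * G.L k * X)
    - (1 / 2 : ℂ) • (X * star (G.L k) * G.L k)) - Complex.I • (X * G.H - G.H * X)

/-- `K(G, Θ)` is the operator for which the Stratonovich generator
`𝓛_G - ½ ∑ ζ_{M_k} ∘ ζ_{M_k}` of the filter is `ζ_{K(G, Θ)}`; this fixes the signs in `KΘ`. -/
theorem lindbladian_sub_eq_zeta (G : OpenSystem n 𝔥) (θ : Fin n → ℝ) (X : 𝔥 →L[ℂ] 𝔥) :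
    G.lindbladian X - (1 / 2 : ℂ) • ∑ k, zeta (G.M θ k) (zeta (G.M θ k) X) =
      zeta (G.KΘ θ) X := by
  have hH : star G.H = G.H := G.selfAdjoint
  have e1 : ∀ k, Complex.exp (2 * Complex.I * (θ k : ℂ)) =
      Complex.exp (Complex.I * (θ k : ℂ)) * Complex.exp (Complex.I * (θ k : ℂ)) := fun k => by
    rw [← Complex.exp_add]; ring_nf
  have e2 : ∀ k, star (Complex.exp (Complex.I * (θ k : ℂ))) *
      Complex.exp (Complex.I * (θ k : ℂ)) = 1 := fun k => by
    rw [Complex.star_def, ← Complex.exp_conj, ← Complex.exp_add]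
    simp
  have key : ∀ k, (star (G.L k) * X * G.L k - (1 / 2 : ℂ) • (star (G.L k) * G.L k * X)
      - (1 / 2 : ℂ) • (X * star (G.L k) * G.L k))
      - (1 / 2 : ℂ) • zeta (G.M θ k) (zeta (G.M θ k) X) =
      zeta (-((1 / 2 : ℂ) • (star (G.L k) * G.L k
        + Complex.exp (2 * Complex.I * (θ k : ℂ)) • (G.L k * G.L k)))) X := fun k => by
    rw [e1 k]
    have h3 : star (1 / 2 : ℂ) = 1 / 2 := by simp
    simp only [zeta, M, mul_add, add_mul, mul_neg, neg_mul, star_neg, star_add, star_smul, star_mul,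
      star_star, smul_mul_assoc, mul_smul_comm, smul_smul, smul_add, mul_assoc, h3]
    match_scalars <;> first | ring1 | linear_combination -(e2 k)
  have hI : star Complex.I = -Complex.I := Complex.conj_I
  rw [lindbladian, Finset.smul_sum, sub_right_comm, ← Finset.sum_sub_distrib,
    Finset.sum_congr rfl fun k _ => key k, KΘ]
  simp only [zeta, Finset.sum_add_distrib, ← Finset.mul_sum, ← Finset.sum_mul, ← star_sum,
    Finset.sum_neg_distrib, ← Finset.smul_sum, mul_sub, sub_mul, star_sub, star_smul, hI, hH,
    mul_smul_comm, smul_mul_assoc]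
  module

variable {Ω : Type*} {mΩ : MeasurableSpace Ω}

/-- `χ` is a solution of the pure-state Belavkin–Zakai equation for complete detection,
`dχ = K χ dt + ∑_k e^{iθ_k} L_k χ dY_k` (Itô), `χ_0 = ψ`. -/
structure IsItoSolution (G : OpenSystem n 𝔥) (θ : Fin n → ℝ) (F : Filtration ℝ≥0 mΩ)
    (P : Measure Ω) (Y : Fin n → ℝ≥0 → Ω → ℝ) (ψ : 𝔥) (χ : ℝ≥0 → Ω → 𝔥) : Prop where
  adapted : StronglyAdapted F χ
  continuous : ∀ᵐ ω ∂P, Continuous fun t => χ t ω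
  equation : ∃ I : Fin n → ℝ≥0 → Ω → 𝔥,
    (∀ k, IsItoIntegral P (fun t ω => G.M θ k (χ t ω)) (Y k) (I k)) ∧
    ∀ᵐ ω ∂P, ∀ t : ℝ≥0,
      χ t ω = ψ + (∫ s in (0 : ℝ)..t, G.K (χ s.toNNReal ω)) + ∑ k, I k t ω

/-- `χ` is a solution of the Stratonovich equation
`dχ = (K(G, Θ) dt + ∑_k e^{iθ_k} L_k dY_k) ∘ χ`, that is,
`dχ = K(G, Θ) χ dt + ∑_k (e^{iθ_k} L_k χ) ∘ dY_k`, with `χ_0 = ψ`. -/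
structure IsStratonovichSolution (G : OpenSystem n 𝔥) (θ : Fin n → ℝ) (F : Filtration ℝ≥0 mΩ)
    (P : Measure Ω) (Y : Fin n → ℝ≥0 → Ω → ℝ) (ψ : 𝔥) (χ : ℝ≥0 → Ω → 𝔥) : Prop where
  adapted : StronglyAdapted F χ
  continuous : ∀ᵐ ω ∂P, Continuous fun t => χ t ω
  equation : ∃ S : Fin n → ℝ≥0 → Ω → 𝔥,
    (∀ k, IsStratonovichIntegral P (fun t ω => G.M θ k (χ t ω)) (Y k) (S k)) ∧
    ∀ᵐ ω ∂P, ∀ t : ℝ≥0,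
      χ t ω = ψ + (∫ s in (0 : ℝ)..t, G.KΘ θ (χ s.toNNReal ω)) + ∑ k, S k t ω

end OpenSystem

end

/-! ### Convergence in probability along a filter -/

section Measure

variable {Ω E ι : Type*} {mΩ : MeasurableSpace Ω} {P : Measure Ω} [NormedAddCommGroup E]
  {l : Filter ι}

/-! The two equations differ only by the Itô correction. Since `M_k ^ 2 = e^{2iθ_k} L_k ^ 2`, one
has `K = KΘ + ½ ∑ M_k ^ 2` (`OpenSystem.K_apply`), so everything rests on the covariation `[M_k χ,
Y_k] = ∫ M_k (M_k χ) dt` (`OpenSystem.isCovariation_M`).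

A solution of either equation is a sum of Itô integrals `∫ M_j χ dY_j` plus a path of locally
bounded variation. The latter has no covariation with the continuous `Y_k`. For the integrals `I = ∫
X dY_j`, the increment of `I` is replaced by its first-order approximation `X ΔY_j`. The resulting
sums of `X ΔY_j ΔY_k` tend to `δ_{jk} ∫ X dt` (`tendstoInMeasure_weighted_covariation`): compensated
products of Brownian increments are orthogonal noises with variance quadratic in the time step, and
the drifts contribute nothing. The replacement is legitimate by Cauchy–Schwarz, because the squared
errors sum to something vanishing in probability (`tendstoInMeasure_remainder`), while `∑ (ΔY_k) ^
2` tends to `t`.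

The Itô integral is known only as a limit in probability of left sums at each fixed time, so the
error estimate is made on a refinement of the partition. There the Brownian part is controlled by a
second-moment bound for truncated coefficients, and the drift part by its variation.

In the converse direction the covariations are unknown, but they are required to have bounded
variation. This already determines the covariation of `χ`, and uniqueness of limits in probability
identifies them. -/

theorem tendstoInMeasure_of_ae_tendsto [IsFiniteMeasure P] [l.IsCountablyGenerated]
    {f : ι → Ω → E} {g : Ω → E} (hf : ∀ i, AEStronglyMeasurable (f i) P)
    (hfg : ∀ᵐ ω ∂P, Tendsto (fun i => f i ω) l (𝓝 (g ω))) : TendstoInMeasure P f l g := by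
  intro ε hε
  -- Almost sure convergence yields convergence in measure for sequences; countable generation of
  -- `l` reduces to that case.
  refine tendsto_iff_seq_tendsto.2 fun u hu => ?_
  exact tendstoInMeasure_of_tendsto_ae (fun n => hf (u n))
    (hfg.mono fun ω hω => hω.comp hu) ε hε

theorem tendstoInMeasure_add {f f' : ι → Ω → E} {g g' : Ω → E}
    (h : TendstoInMeasure P f l g) (h' : TendstoInMeasure P f' l g') :
    TendstoInMeasure P (fun i ω => f i ω + f' i ω) l (fun ω => g ω + g' ω) := by
  rw [tendstoInMeasure_iff_norm] at *
  intro ε hε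
  have := (h (ε / 2) (half_pos hε)).add (h' (ε / 2) (half_pos hε))
  rw [add_zero] at this
  refine tendsto_of_tendsto_of_tendsto_of_le_of_le tendsto_const_nhds this (fun _ => zero_le)
    fun i => (measure_mono fun ω hω => ?_).trans (measure_union_le _ _)
  by_contra hc
  simp only [Set.mem_union, Set.mem_ofPred_eq, not_or, not_le] at hc hω
  have := norm_add_le (f i ω - g ω) (f' i ω - g' ω)
  rw [show f i ω - g ω + (f' i ω - g' ω) = f i ω + f' i ω - (g ω + g' ω) by abel] at this
  linarith [hc.1, hc.2]

theorem tendstoInMeasure_finset_sum {κ : Type*} (s : Finset κ) {f : κ → ι → Ω → E}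
    {g : κ → Ω → E} (h : ∀ k ∈ s, TendstoInMeasure P (f k) l (g k)) :
    TendstoInMeasure P (fun i ω => ∑ k ∈ s, f k i ω) l (fun ω => ∑ k ∈ s, g k ω) := by
  classical
  induction s using Finset.induction_on with
  | empty =>
    intro ε hε
    simpa [hε.ne'] using tendsto_const_nhds
  | insert a s ha ih =>
    simp only [Finset.sum_insert ha]
    exact tendstoInMeasure_add (h a (Finset.mem_insert_self _ _))
      (ih fun k hk => h k (Finset.mem_insert_of_mem hk))

theorem tendstoInMeasure_map_continuousLinear {𝕜 F : Type*} [NontriviallyNormedField 𝕜]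
    [NormedSpace 𝕜 E] [NormedAddCommGroup F] [NormedSpace 𝕜 F] (T : E →L[𝕜] F)
    {f : ι → Ω → E} {g : Ω → E} (h : TendstoInMeasure P f l g) :
    TendstoInMeasure P (fun i ω => T (f i ω)) l (fun ω => T (g ω)) := by
  rw [tendstoInMeasure_iff_norm] at *
  intro ε hε
  have hT : 0 < ‖T‖ + 1 := by positivity
  refine tendsto_of_tendsto_of_tendsto_of_le_of_le tendsto_const_nhds
    (h (ε / (‖T‖ + 1)) (by positivity)) (fun _ => zero_le)
    fun i => measure_mono fun ω hω => ?_
  simp only [Set.mem_ofPred_eq] at hω ⊢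
  rw [div_le_iff₀ hT]
  rw [← map_sub] at hω
  have := T.le_opNorm (f i ω - g ω)
  nlinarith [norm_nonneg (f i ω - g ω)]

/-- The form in which Cauchy–Schwarz is used: `g` is bounded above by `|c| + 1` outside a set of
small probability, so the product inherits the decay of `f`. -/
theorem tendstoInMeasure_zero_of_sq_norm_le {F : Type*} [NormedAddCommGroup F] {f g : ι → Ω → ℝ}
    {c : ℝ} {h : ι → Ω → F} (hf : TendstoInMeasure P f l fun _ => 0)
    (hg : TendstoInMeasure P g l fun _ => c)
    (hf0 : ∀ i ω, 0 ≤ f i ω) (hle : ∀ i ω, ‖h i ω‖ ^ 2 ≤ f i ω * g i ω) :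
    TendstoInMeasure P h l fun _ => 0 := by
  rw [tendstoInMeasure_iff_norm] at *
  intro ε hε
  have hc : 0 < |c| + 1 := by positivity
  have := (hf (ε ^ 2 / (|c| + 1)) (by positivity)).add (hg 1 one_pos)
  rw [add_zero] at this
  refine tendsto_of_tendsto_of_tendsto_of_le_of_le tendsto_const_nhds this (fun _ => zero_le)
    fun i => (measure_mono fun ω hω => ?_).trans (measure_union_le _ _)
  by_contra hcon
  simp only [Set.mem_union, Set.mem_ofPred_eq, not_or, not_le, sub_zero, Real.norm_eq_abs]
    at hcon hω
  obtain ⟨h1, h2⟩ := hcon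
  rw [abs_of_nonneg (hf0 i ω), lt_div_iff₀ hc] at h1
  have h3 : g i ω ≤ |c| + 1 := by
    have := (abs_lt.1 h2).2
    have := le_abs_self c
    linarith
  have h4 := hle i ω
  have h5 : ε ^ 2 ≤ ‖h i ω‖ ^ 2 := by gcongr
  have h6 := mul_le_mul_of_nonneg_left h3 (hf0 i ω)
  linarith

/-- Convergence to zero in probability from eventual smallness on each set of an exhausting
sequence, outside small exceptional sets. The sets need not be measurable. -/
theorem tendstoInMeasure_zero_of_exhaustion [IsProbabilityMeasure P] {f : ι → Ω → E}
    (hf : ∀ i, AEStronglyMeasurable (f i) P)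
    (h : ∀ ε > 0, ∀ η > 0, ∃ A : ℕ → Set Ω, Monotone A ∧ (∀ᵐ ω ∂P, ∃ r, ω ∈ A r) ∧
      ∀ r, ∀ᶠ i in l, ∃ B, P.real B ≤ η ∧ ∀ ω ∈ A r, ω ∉ B → ‖f i ω‖ < ε) :
    TendstoInMeasure P f l fun _ => 0 := by
  rw [tendstoInMeasure_iff_measureReal_norm]
  intro ε hε
  rw [Metric.tendsto_nhds]
  intro η hη
  obtain ⟨A, hA, hall, hev⟩ := h ε hε (η / 3) (by positivity)
  -- Continuity from below holds for the outer measure of arbitrary increasing sets. Only the set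
  -- `S` below has to be null measurable, in order to pass to its complement.
  have h1 : Tendsto (fun r => P.real (A r)) atTop (𝓝 1) := by
    have h2 := tendsto_measure_iUnion_atTop (μ := P) hA
    have h3 : P (⋃ r, A r) = 1 := by
      rw [← measure_univ (μ := P)]
      refine measure_congr ?_
      filter_upwards [hall] with ω hω
      exact propext ⟨fun _ => trivial, fun _ => Set.mem_iUnion.2 hω⟩
    rw [h3] at h2
    exact (ENNReal.tendsto_toReal ENNReal.one_ne_top).comp h2
  obtain ⟨r, hr⟩ := (h1.eventually (lt_mem_nhds (show 1 - η / 3 < 1 by linarith))).exists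
  filter_upwards [hev r] with i hi
  obtain ⟨B, hB, hAB⟩ := hi
  set S := {ω | ε ≤ ‖f i ω - 0‖} with hS
  have hSm : NullMeasurableSet S P :=
    nullMeasurableSet_le aemeasurable_const ((hf i).sub aestronglyMeasurable_const).norm.aemeasurable
  have h4 : P.real S + P.real Sᶜ = 1 := by
    have := measure_add_measure_compl₀ hSm
    rw [measure_univ] at this
    rw [measureReal_def, measureReal_def, ← ENNReal.toReal_add (measure_ne_top _ _)
      (measure_ne_top _ _), this, ENNReal.toReal_one]
  have h5 : P.real (A r) ≤ P.real Sᶜ + P.real B := by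
    refine (measureReal_mono (fun ω hω => ?_) (measure_ne_top _ _)).trans (measureReal_union_le _ _)
    by_cases hb : ω ∈ B
    · exact Or.inr hb
    · left
      simpa [hS] using hAB ω hω hb
  rw [Real.dist_eq, sub_zero, abs_of_nonneg measureReal_nonneg]
  linarith

theorem measureReal_le_integral_sq_div [IsFiniteMeasure P] {f : Ω → E} (hf : MemLp f 2 P) {ε : ℝ}
    (hε : 0 < ε) : P.real {ω | ε ≤ ‖f ω‖} ≤ (∫ ω, ‖f ω‖ ^ 2 ∂P) / ε ^ 2 := by
  have h := mul_meas_ge_le_integral_of_nonneg (μ := P) (f := fun ω => ‖f ω‖ ^ 2)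
    (ae_of_all _ fun ω => by positivity) hf.norm.integrable_sq (ε ^ 2)
  rw [le_div_iff₀ (by positivity), mul_comm]
  refine le_trans (le_of_eq ?_) h
  congr 2
  ext ω
  simp only [Set.mem_ofPred_eq]
  rw [sq_le_sq₀ hε.le (norm_nonneg _)]

end Measure

/-! ### Bounded variation, moduli of continuity and Riemann sums along partitions -/

section Paths

variable {E F : Type*} [NormedAddCommGroup E] [NormedAddCommGroup F]

/-- The variation of `v` along finite partitions of `[0, t]` is at most `V`. -/
def VariationLE (v : ℝ≥0 → E) (t : ℝ≥0) (V : ℝ) : Prop :=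
  ∀ u : ℕ → ℝ≥0, Monotone u → ∀ n, u n ≤ t →
    ∑ i ∈ Finset.range n, ‖v (u (i + 1)) - v (u i)‖ ≤ V

theorem VariationLE.nonneg {v : ℝ≥0 → E} {t : ℝ≥0} {V : ℝ} (h : VariationLE v t V) : 0 ≤ V := by
  simpa using h (fun _ => 0) monotone_const 0 zero_le

theorem VariationLE.sum {v : ℝ≥0 → E} {t : ℝ≥0} {V : ℝ} (h : VariationLE v t V)
    (p : TimePartition t) :
    ∑ i ∈ Finset.range p.N, ‖v (p.pt (i + 1)) - v (p.pt i)‖ ≤ V :=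
  h p.pt p.mono p.N p.pt_last.le

theorem LocallyBoundedVariationOn.exists_variationLE {v : ℝ≥0 → E}
    (h : LocallyBoundedVariationOn v Set.univ) (t : ℝ≥0) : ∃ V, VariationLE v t V := by
  have hb : BoundedVariationOn v (Set.univ ∩ Set.Icc 0 t) := h 0 t trivial trivial
  refine ⟨(eVariationOn v (Set.univ ∩ Set.Icc 0 t)).toReal, fun u hu n hn => ?_⟩
  have h1 := eVariationOn.sum_le_of_monotoneOn_Iic (f := v) (s := Set.univ ∩ Set.Icc 0 t) (n := n)
    (hu.monotoneOn _) (fun i hi => ⟨trivial, zero_le, (hu hi).trans hn⟩)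
  have h2 := ENNReal.toReal_mono hb h1
  rw [ENNReal.toReal_sum (fun _ _ => edist_ne_top _ _)] at h2
  simpa [← dist_edist, dist_eq_norm] using h2

theorem locallyBoundedVariationOn_of_variationLE {v : ℝ≥0 → E}
    (h : ∀ t, ∃ V, VariationLE v t V) : LocallyBoundedVariationOn v Set.univ := by
  intro a b _ _
  obtain ⟨V, hV⟩ := h b
  refine ne_top_of_le_ne_top (ENNReal.ofReal_ne_top (r := V)) (iSup_le fun q => ?_)
  have h1 := hV (q.2.1 ·) q.2.2.1 q.1 (q.2.2.2 q.1).2.2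
  refine le_trans (le_of_eq ?_) (ENNReal.ofReal_le_ofReal h1)
  rw [ENNReal.ofReal_sum_of_nonneg (fun _ _ => norm_nonneg _)]
  simp [edist_dist, dist_eq_norm]

theorem VariationLE.add {v w : ℝ≥0 → E} {t : ℝ≥0} {V W : ℝ} (hv : VariationLE v t V)
    (hw : VariationLE w t W) : VariationLE (fun s => v s + w s) t (V + W) := by
  intro u hu n hn
  refine le_trans ?_ (add_le_add (hv u hu n hn) (hw u hu n hn))
  rw [← Finset.sum_add_distrib]
  refine Finset.sum_le_sum fun i _ => ?_
  rw [add_sub_add_comm]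
  exact norm_add_le _ _

theorem LocallyBoundedVariationOn.add_path {v w : ℝ≥0 → E}
    (hv : LocallyBoundedVariationOn v Set.univ) (hw : LocallyBoundedVariationOn w Set.univ) :
    LocallyBoundedVariationOn (fun s => v s + w s) Set.univ := by
  refine locallyBoundedVariationOn_of_variationLE fun t => ?_
  obtain ⟨V, hV⟩ := hv.exists_variationLE t
  obtain ⟨W, hW⟩ := hw.exists_variationLE t
  exact ⟨_, hV.add hW⟩

theorem LocallyBoundedVariationOn.const_smul_path [NormedSpace ℝ E] {v : ℝ≥0 → E}
    (hv : LocallyBoundedVariationOn v Set.univ) (c : ℝ) :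
    LocallyBoundedVariationOn (fun s => c • v s) Set.univ := by
  refine locallyBoundedVariationOn_of_variationLE fun t => ?_
  obtain ⟨V, hV⟩ := hv.exists_variationLE t
  refine ⟨|c| * V, fun u hu n hn => ?_⟩
  simp_rw [← smul_sub, norm_smul, ← Finset.mul_sum, Real.norm_eq_abs]
  exact mul_le_mul_of_nonneg_left (hV u hu n hn) (abs_nonneg c)

theorem locallyBoundedVariationOn_const_path (c : E) :
    LocallyBoundedVariationOn (fun _ : ℝ≥0 => c) Set.univ :=
  locallyBoundedVariationOn_of_variationLE fun _ => ⟨0, fun _ _ _ _ => by simp⟩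

theorem LocallyBoundedVariationOn.sum_path {κ : Type*} (s : Finset κ) {v : κ → ℝ≥0 → E}
    (hv : ∀ k, LocallyBoundedVariationOn (v k) Set.univ) :
    LocallyBoundedVariationOn (fun t => ∑ k ∈ s, v k t) Set.univ := by
  classical
  induction s using Finset.induction_on with
  | empty => simpa using locallyBoundedVariationOn_const_path (0 : E)
  | insert a s ha ih =>
    simp only [Finset.sum_insert ha]
    exact (hv a).add_path ih

theorem locallyBoundedVariationOn_primitive [NormedSpace ℝ E] {f : ℝ → E}
    (hf : ∀ t : ℝ≥0, IntervalIntegrable f volume 0 t) :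
    LocallyBoundedVariationOn (fun t : ℝ≥0 => ∫ s in (0 : ℝ)..t, f s) Set.univ := by
  refine locallyBoundedVariationOn_of_variationLE fun t => ⟨∫ s in (0 : ℝ)..t, ‖f s‖, ?_⟩
  intro u hu n hn
  have hi : ∀ a b : ℝ≥0, IntervalIntegrable f volume a b := fun a b => (hf a).symm.trans (hf b)
  calc ∑ i ∈ Finset.range n, ‖(∫ s in (0 : ℝ)..u (i + 1), f s) - ∫ s in (0 : ℝ)..u i, f s‖
      ≤ ∑ i ∈ Finset.range n, ∫ s in (u i : ℝ)..u (i + 1), ‖f s‖ := by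
        refine Finset.sum_le_sum fun i _ => ?_
        rw [intervalIntegral.integral_interval_sub_left (hf _) (hf _)]
        exact intervalIntegral.norm_integral_le_integral_norm (by exact_mod_cast hu i.le_succ)
    _ = ∫ s in (u 0 : ℝ)..u n, ‖f s‖ :=
        intervalIntegral.sum_integral_adjacent_intervals (a := fun i => (u i : ℝ))
          fun k _ => (hi _ _).norm
    _ ≤ ∫ s in (0 : ℝ)..t, ‖f s‖ := by
        refine intervalIntegral.integral_mono_interval (by positivity)
          (by exact_mod_cast hu (Nat.zero_le n)) (by exact_mod_cast hn)
          (ae_of_all _ fun _ => norm_nonneg _) (hf t).norm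

theorem continuous_primitive_nnreal [NormedSpace ℝ E] {f : ℝ → E}
    (hf : ∀ t : ℝ≥0, IntervalIntegrable f volume 0 t) :
    Continuous (fun t : ℝ≥0 => ∫ s in (0 : ℝ)..t, f s) := by
  rw [continuous_iff_continuousAt]
  intro t
  have h1 := intervalIntegral.continuousOn_primitive_interval (μ := volume) (f := f) (a := 0)
    (b := ((t + 1 : ℝ≥0) : ℝ)) (((intervalIntegrable_iff' (by simp)).1 (hf (t + 1))))
  have h2 : Set.MapsTo (fun s : ℝ≥0 => (s : ℝ)) (Set.Iio (t + 1))
      (Set.uIcc 0 ((t + 1 : ℝ≥0) : ℝ)) := by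
    intro s hs
    rw [Set.uIcc_of_le (by positivity)]
    exact ⟨s.2, by exact_mod_cast (le_of_lt hs)⟩
  have h3 := h1.comp NNReal.continuous_coe.continuousOn h2
  exact h3.continuousAt (Iio_mem_nhds (by simp))

theorem exists_uniform_modulus {u : ℝ≥0 → E} (hu : Continuous u) (t : ℝ≥0) {ε : ℝ} (hε : 0 < ε) :
    ∃ δ > 0, ∀ s ≤ t, ∀ s' ≤ t, dist s s' < δ → ‖u s - u s'‖ < ε := by
  have h := isCompact_Icc.uniformContinuousOn_of_continuous (hu.continuousOn (s := Set.Icc 0 t))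
  obtain ⟨δ, hδ, h⟩ := Metric.uniformContinuousOn_iff.1 h ε hε
  refine ⟨δ, hδ, fun s hs s' hs' hd => ?_⟩
  rw [← dist_eq_norm]
  exact h s ⟨zero_le, hs⟩ s' ⟨zero_le, hs'⟩ hd

namespace TimePartition

variable {t : ℝ≥0} (p : TimePartition t)

theorem pt_le {i : ℕ} (hi : i ≤ p.N) : p.pt i ≤ t :=
  (p.mono hi).trans_eq p.pt_last

theorem sub_le_mesh {i : ℕ} (hi : i < p.N) : p.pt (i + 1) - p.pt i ≤ p.mesh :=
  Finset.le_sup (f := fun i => p.pt (i + 1) - p.pt i) (Finset.mem_range.2 hi)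

theorem coe_sub_le_mesh {i : ℕ} (hi : i < p.N) : (p.pt (i + 1) - p.pt i : ℝ) ≤ p.mesh := by
  rw [← NNReal.coe_sub (p.mono i.le_succ)]
  exact_mod_cast p.sub_le_mesh hi

theorem coe_le_succ (i : ℕ) : (p.pt i : ℝ) ≤ p.pt (i + 1) := by
  exact_mod_cast p.mono i.le_succ

theorem dist_le_mesh {i : ℕ} (hi : i < p.N) {s s' : ℝ≥0} (hs : s ∈ Set.Icc (p.pt i) (p.pt (i + 1)))
    (hs' : s' ∈ Set.Icc (p.pt i) (p.pt (i + 1))) : dist s s' ≤ p.mesh := by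
  have h := p.coe_sub_le_mesh hi
  have h1 : (p.pt i : ℝ) ≤ s := hs.1
  have h2 : (s : ℝ) ≤ p.pt (i + 1) := hs.2
  have h3 : (p.pt i : ℝ) ≤ s' := hs'.1
  have h4 : (s' : ℝ) ≤ p.pt (i + 1) := hs'.2
  rw [NNReal.dist_eq, abs_le]
  constructor <;> linarith

theorem sum_sub : ∑ i ∈ Finset.range p.N, (p.pt (i + 1) - p.pt i : ℝ) = t := by
  rw [Finset.sum_range_sub (fun i => (p.pt i : ℝ)), p.pt_zero, p.pt_last]
  simp

end TimePartition

instance (t : ℝ≥0) : (meshToZero t).IsCountablyGenerated := by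
  unfold meshToZero; infer_instance

theorem eventually_mesh_lt (t : ℝ≥0) {δ : ℝ} (hδ : 0 < δ) :
    ∀ᶠ p in meshToZero t, (p.mesh : ℝ) < δ := by
  have h : Tendsto (fun p : TimePartition t => (p.mesh : ℝ)) (meshToZero t) (𝓝 0) := by
    have := (NNReal.continuous_coe.tendsto 0).comp (tendsto_comap (f := TimePartition.mesh (t := t)))
    exact this
  exact h.eventually (gt_mem_nhds hδ)

/-- The sum is at most the oscillation of `u` at the scale of the mesh times the variation of `v`.
This is why drifts and other bounded-variation terms drop out of covariations; `v` may have jumps.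
-/
theorem tendsto_sum_norm_mul_norm {u : ℝ≥0 → E} {v : ℝ≥0 → F} (hu : Continuous u)
    (hv : LocallyBoundedVariationOn v Set.univ) (t : ℝ≥0) :
    Tendsto (fun p : TimePartition t => ∑ i ∈ Finset.range p.N,
      ‖u (p.pt (i + 1)) - u (p.pt i)‖ * ‖v (p.pt (i + 1)) - v (p.pt i)‖) (meshToZero t) (𝓝 0) := by
  obtain ⟨V, hV⟩ := hv.exists_variationLE t
  have hV0 := hV.nonneg
  rw [Metric.tendsto_nhds]
  intro ε hε
  obtain ⟨δ, hδ, h⟩ := exists_uniform_modulus hu t (ε := ε / (V + 1)) (by positivity)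
  filter_upwards [eventually_mesh_lt t hδ] with p hp
  rw [Real.dist_eq, sub_zero, abs_of_nonneg (Finset.sum_nonneg fun _ _ => by positivity)]
  calc _ ≤ ∑ i ∈ Finset.range p.N, ε / (V + 1) * ‖v (p.pt (i + 1)) - v (p.pt i)‖ := by
        refine Finset.sum_le_sum fun i hi => ?_
        have hi' := Finset.mem_range.1 hi
        refine mul_le_mul_of_nonneg_right (h _ (p.pt_le hi') _ (p.pt_le hi'.le) ?_).le
          (norm_nonneg _)
        exact (p.dist_le_mesh hi' ⟨p.mono i.le_succ, le_rfl⟩ ⟨le_rfl, p.mono i.le_succ⟩).trans_lt hp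
    _ = ε / (V + 1) * ∑ i ∈ Finset.range p.N, ‖v (p.pt (i + 1)) - v (p.pt i)‖ :=
        (Finset.mul_sum _ _ _).symm
    _ ≤ ε / (V + 1) * V := by gcongr; exact hV.sum p
    _ < ε := by rw [div_mul_eq_mul_div, div_lt_iff₀ (by positivity)]; nlinarith

theorem tendsto_riemannSum [NormedSpace ℝ E] [CompleteSpace E] {x : ℝ≥0 → E} (hx : Continuous x)
    (t : ℝ≥0) :
    Tendsto (fun p : TimePartition t => ∑ i ∈ Finset.range p.N,
      (p.pt (i + 1) - p.pt i : ℝ) • x (p.pt i)) (meshToZero t)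
      (𝓝 (∫ s in (0 : ℝ)..t, x s.toNNReal)) := by
  rw [Metric.tendsto_nhds]
  intro ε hε
  obtain ⟨δ, hδ, h⟩ := exists_uniform_modulus hx t (ε := ε / (t + 1)) (by positivity)
  have hc : Continuous fun s : ℝ => x s.toNNReal := hx.comp continuous_real_toNNReal
  filter_upwards [eventually_mesh_lt t hδ] with p hp
  have h0 : ∫ s in (0 : ℝ)..t, x s.toNNReal =
      ∑ i ∈ Finset.range p.N, ∫ s in (p.pt i : ℝ)..p.pt (i + 1), x s.toNNReal := by
    rw [intervalIntegral.sum_integral_adjacent_intervals (a := fun i => (p.pt i : ℝ))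
      fun k _ => hc.intervalIntegrable _ _, p.pt_zero, p.pt_last]
    rfl
  rw [dist_comm, dist_eq_norm, h0, ← Finset.sum_sub_distrib]
  calc _ ≤ ∑ i ∈ Finset.range p.N, ε / (t + 1) * (p.pt (i + 1) - p.pt i : ℝ) := by
        refine norm_sum_le_of_le _ fun i hi => ?_
        have hi' := Finset.mem_range.1 hi
        rw [← intervalIntegral.integral_const, ← intervalIntegral.integral_sub
          (hc.intervalIntegrable _ _) intervalIntegrable_const]
        refine (intervalIntegral.norm_integral_le_of_norm_le_const (C := ε / (t + 1))
          fun s hs => ?_).trans_eq ?_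
        · rw [Set.uIoc_of_le (p.coe_le_succ i)] at hs
          have hs1 : p.pt i ≤ s.toNNReal := by
            exact NNReal.le_toNNReal_of_coe_le hs.1.le
          have hs2 : s.toNNReal ≤ p.pt (i + 1) := Real.toNNReal_le_iff_le_coe.2 hs.2
          exact (h _ (hs2.trans (p.pt_le hi')) _ (p.pt_le hi'.le)
            ((p.dist_le_mesh hi' ⟨hs1, hs2⟩ ⟨le_rfl, p.mono i.le_succ⟩).trans_lt hp)).le
        · rw [abs_of_nonneg (sub_nonneg.2 (p.coe_le_succ i))]
    _ = ε / (t + 1) * t := by rw [← Finset.mul_sum, p.sum_sub]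
    _ < ε := by rw [div_mul_eq_mul_div, div_lt_iff₀ (by positivity)]; nlinarith

end Paths

/-! ### Refinement of a partition -/

namespace TimePartition

variable {t : ℝ≥0} (p : TimePartition t)

/-- The grid obtained by dividing every interval of `p` into `m` equal pieces. -/
noncomputable def gridPt (m l : ℕ) : ℝ≥0 :=
  ∑ l' ∈ Finset.range l, (p.pt (l' / m + 1) - p.pt (l' / m)) / m

theorem gridPt_succ (m l : ℕ) :
    p.gridPt m (l + 1) = p.gridPt m l + (p.pt (l / m + 1) - p.pt (l / m)) / m :=
  Finset.sum_range_succ _ _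

theorem gridPt_mono (m : ℕ) : Monotone (p.gridPt m) :=
  monotone_nat_of_le_succ fun l => by rw [gridPt_succ]; exact le_self_add

theorem gridPt_mul {m : ℕ} (hm : 0 < m) (i : ℕ) : p.gridPt m (i * m) = p.pt i := by
  induction i with
  | zero => simp [gridPt, p.pt_zero]
  | succ i ih =>
    rw [gridPt, Nat.add_mul, one_mul, Finset.sum_range_add]
    rw [gridPt] at ih
    rw [ih]
    have : ∀ r ∈ Finset.range m, (p.pt ((i * m + r) / m + 1) - p.pt ((i * m + r) / m)) / (m : ℝ≥0) =
        (p.pt (i + 1) - p.pt i) / m := by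
      intro r hr
      rw [Nat.add_comm (i * m), Nat.add_mul_div_right _ _ hm, Nat.div_eq_of_lt (Finset.mem_range.1 hr),
        zero_add]
    rw [Finset.sum_congr rfl this, Finset.sum_const, Finset.card_range, nsmul_eq_mul,
      mul_div_cancel₀ _ (by exact_mod_cast hm.ne'), add_tsub_cancel_of_le (p.mono i.le_succ)]

theorem gridPt_mem {m : ℕ} (hm : 0 < m) (i : ℕ) {r : ℕ} (hr : r ≤ m) :
    p.gridPt m (i * m + r) ∈ Set.Icc (p.pt i) (p.pt (i + 1)) := by
  rw [← p.gridPt_mul hm i, ← p.gridPt_mul hm (i + 1)]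
  exact ⟨p.gridPt_mono m (Nat.le_add_right _ _), p.gridPt_mono m (by rw [Nat.add_mul]; omega)⟩

/-- The grid with `m + 1` points per interval of `p`, as a partition of `[0, p.pt i]`. -/
noncomputable def refine (i m : ℕ) : TimePartition (p.pt i) where
  -- Only the number of points depends on `i`; the grid is the same for all `i`, so left sums for
  -- consecutive `i` differ by exactly one block.
  N := i * (m + 1)
  pt := p.gridPt (m + 1)
  mono := p.gridPt_mono _
  pt_zero := by simp [gridPt]
  pt_last := p.gridPt_mul m.succ_pos i

theorem mesh_refine_le (i m : ℕ) : (p.refine i m).mesh ≤ p.pt i / (m + 1 : ℕ) := by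
  refine Finset.sup_le fun l hl => ?_
  have hl' : l / (m + 1) < i := (Nat.div_lt_iff_lt_mul m.succ_pos).2 (Finset.mem_range.1 hl)
  change p.gridPt (m + 1) (l + 1) - p.gridPt (m + 1) l ≤ _
  rw [gridPt_succ, add_tsub_cancel_left]
  gcongr
  -- The length of an interval is bounded crudely by its right endpoint, which suffices because `p`
  -- stays fixed while `m` grows.
  exact tsub_le_self.trans (p.mono hl')

theorem tendsto_refine (i : ℕ) : Tendsto (p.refine i) atTop (meshToZero (p.pt i)) := by
  rw [meshToZero, tendsto_comap_iff]
  refine tendsto_of_tendsto_of_tendsto_of_le_of_le tendsto_const_nhds ?_ (fun _ => zero_le)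
    (p.mesh_refine_le i)
  have h := (tendsto_const_div_atTop_nhds_zero_nat (p.pt i : ℝ)).comp (tendsto_add_atTop_nat 1)
  rw [← NNReal.tendsto_coe]
  exact h.congr fun n => by simp

/-- The partition of `[0, t]` with one interval. -/
noncomputable def single (t : ℝ≥0) : TimePartition t where
  N := 1
  pt i := if i = 0 then 0 else t
  mono := by
    intro i j hij
    by_cases hi : i = 0
    · simp [hi]
    · have hj : j ≠ 0 := by omega
      simp [hi, hj]
  pt_zero := by simp
  pt_last := by simp

end TimePartition

/-- Equal subdivisions of the single interval have mesh tending to zero. Uniqueness and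
measurability of limits in probability depend on this. -/
instance (t : ℝ≥0) : (meshToZero t).NeBot := by
  have h := ((TimePartition.single t).tendsto_refine 1).neBot
  rwa [show (TimePartition.single t).pt 1 = t from (TimePartition.single t).pt_last] at h

/-! ### Second moments of discrete stochastic integrals -/

section Noise

variable {Ω E : Type*} {mΩ : MeasurableSpace Ω} {P : Measure Ω}
  {F : Filtration ℝ≥0 mΩ}

/-- A centred square-integrable random variable, measurable at time `t`, independent of the past
before time `s`, of variance at most `c`. -/
structure IsNoise (F : Filtration ℝ≥0 mΩ) (P : Measure Ω) (s t : ℝ≥0) (ξ : Ω → ℝ) (c : ℝ) :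
    Prop where
  measurable : StronglyMeasurable[F t] ξ
  indep : Indep (F s) (MeasurableSpace.comap ξ inferInstance) P
  memLp : MemLp ξ 2 P
  mean : ∫ ω, ξ ω ∂P = 0
  variance_le : ∫ ω, ξ ω ^ 2 ∂P ≤ c

theorem IsNoise.nonneg {s t : ℝ≥0} {ξ : Ω → ℝ} {c : ℝ} (h : IsNoise F P s t ξ c) : 0 ≤ c :=
  (integral_nonneg fun _ => sq_nonneg _).trans h.variance_le

variable [NormedAddCommGroup E] [InnerProductSpace ℝ E]

/-- Discrete Itô isometry, as an inequality: each new term is orthogonal to the preceding sum, so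
the second moments add up. -/
theorem martingaleTransform_sq_le {τ : ℕ → ℝ≥0} (hτ : Monotone τ) {ξ : ℕ → Ω → ℝ} {c : ℕ → ℝ}
    {V : ℕ → Ω → E} {b : ℝ} {n : ℕ} (hξ : ∀ i < n, IsNoise F P (τ i) (τ (i + 1)) (ξ i) (c i))
    (hV : ∀ i < n, StronglyMeasurable[F (τ i)] (V i)) (hb : ∀ i < n, ∀ ω, ‖V i ω‖ ≤ b) :
    StronglyMeasurable[F (τ n)] (fun ω => ∑ i ∈ Finset.range n, ξ i ω • V i ω) ∧
      MemLp (fun ω => ∑ i ∈ Finset.range n, ξ i ω • V i ω) 2 P ∧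
      ∫ ω, ‖∑ i ∈ Finset.range n, ξ i ω • V i ω‖ ^ 2 ∂P ≤ b ^ 2 * ∑ i ∈ Finset.range n, c i := by
  induction n with
  | zero => simp [stronglyMeasurable_const]
  | succ n ih =>
    obtain ⟨h1, h2, h3⟩ := ih (fun i hi => hξ i (by omega)) (fun i hi => hV i (by omega))
      fun i hi => hb i (by omega)
    have hN := hξ n n.lt_succ_self
    have hVn := hV n n.lt_succ_self
    have hbn := hb n n.lt_succ_self
    simp only [Finset.sum_range_succ]
    set S : Ω → E := fun ω => ∑ i ∈ Finset.range n, ξ i ω • V i ω with hS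
    have hmono := F.mono (hτ n.le_succ)
    have hVm : StronglyMeasurable (V n) := hVn.mono (F.le _)
    have hSm : StronglyMeasurable S := h1.mono (F.le _)
    have hξm : StronglyMeasurable (ξ n) := hN.measurable.mono (F.le _)
    have hT : MemLp (fun ω => ξ n ω • V n ω) 2 P := by
      refine hN.memLp.of_le_mul (c := b) (hξm.smul hVm).aestronglyMeasurable
        (ae_of_all _ fun ω => ?_)
      rw [norm_smul, mul_comm]
      exact mul_le_mul_of_nonneg_right (hbn ω) (norm_nonneg _)
    refine ⟨(h1.mono hmono).add (hN.measurable.smul (hVn.mono hmono)), h2.add hT, ?_⟩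
    -- The integrand is `ξ n` times `⟪S, V n⟫`; the second factor is known at time `τ n`, hence
    -- independent of the centred `ξ n`.
    have hcross : ∫ ω, inner ℝ (S ω) (ξ n ω • V n ω) ∂P = 0 := by
      have hinner : StronglyMeasurable[F (τ n)] fun ω => inner ℝ (S ω) (V n ω) := h1.inner hVn
      have hi : IndepFun (ξ n) (fun ω => inner ℝ (S ω) (V n ω)) P := by
        refine indep_of_indep_of_le_right hN.indep.symm ?_
        exact hinner.measurable.comap_le
      have := hi.integral_fun_mul_eq_mul_integral hξm.aestronglyMeasurable
        (hinner.mono (F.le _)).aestronglyMeasurable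
      simp only [inner_smul_right]
      rw [this, hN.mean, zero_mul]
    have hIcross : Integrable (fun ω => inner ℝ (S ω) (ξ n ω • V n ω)) P :=
      (h2.norm.integrable_mul hT.norm).mono'
        (hSm.inner (hξm.smul hVm)).aestronglyMeasurable
        (ae_of_all _ fun ω => norm_inner_le_norm _ _)
    have hIS := h2.norm.integrable_sq
    have hIT := hT.norm.integrable_sq
    calc ∫ ω, ‖S ω + ξ n ω • V n ω‖ ^ 2 ∂P
        = ∫ ω, ‖S ω‖ ^ 2 + 2 * inner ℝ (S ω) (ξ n ω • V n ω) + ‖ξ n ω • V n ω‖ ^ 2 ∂P := by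
          simp only [norm_add_sq_real]
      _ = ∫ ω, ‖S ω‖ ^ 2 ∂P + ∫ ω, ‖ξ n ω • V n ω‖ ^ 2 ∂P := by
          have hsum : Integrable (fun ω => ‖S ω‖ ^ 2 + 2 * inner ℝ (S ω) (ξ n ω • V n ω)) P :=
            hIS.add (hIcross.const_mul 2)
          rw [integral_add hsum hIT,
            integral_add hIS (hIcross.const_mul 2), integral_const_mul, hcross, mul_zero, add_zero]
      _ ≤ b ^ 2 * ∑ i ∈ Finset.range n, c i + b ^ 2 * c n := by
          refine add_le_add h3 ?_
          refine le_trans ?_ (mul_le_mul_of_nonneg_left hN.variance_le (sq_nonneg b))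
          rw [← integral_const_mul]
          refine integral_mono hIT (hN.memLp.integrable_sq.const_mul _) fun ω => ?_
          simp only [norm_smul, mul_pow, Real.norm_eq_abs, sq_abs]
          rw [mul_comm]
          have := hbn ω
          gcongr
      _ = b ^ 2 * (∑ i ∈ Finset.range n, c i + c n) := (mul_add _ _ _).symm

end Noise

/-! ### Moments of Brownian increments -/

section Brownian

variable {Ω : Type*} {mΩ : MeasurableSpace Ω} {P : Measure Ω}
  {F : Filtration ℝ≥0 mΩ} {n : ℕ} {W : Fin n → ℝ≥0 → Ω → ℝ}

/-- The fourth moment of the standard Gaussian law. -/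
noncomputable def gaussianFourthMoment : ℝ := ∫ x, x ^ 4 ∂gaussianReal 0 1

theorem gaussianFourthMoment_nonneg : 0 ≤ gaussianFourthMoment :=
  integral_nonneg fun _ => by positivity

theorem integral_pow_four_gaussianReal (v : ℝ≥0) :
    ∫ x, x ^ 4 ∂gaussianReal 0 v = gaussianFourthMoment * v ^ 2 := by
  -- Scaling by `√v` from the standard law; the numerical value of the fourth moment is never
  -- needed.
  have h := gaussianReal_map_const_mul (μ := 0) (v := 1) (√(v : ℝ))
  have hv : NNReal.mk (√(v : ℝ) ^ 2) (sq_nonneg _) * 1 = v := by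
    ext; simp
  rw [mul_zero, hv] at h
  rw [← h, integral_map (by fun_prop) (by fun_prop), gaussianFourthMoment, mul_comm,
    ← integral_const_mul]
  refine integral_congr_ae (ae_of_all _ fun x => ?_)
  have : √(v : ℝ) ^ 4 = (v : ℝ) ^ 2 := by
    rw [show 4 = 2 * 2 from rfl, pow_mul, Real.sq_sqrt (NNReal.coe_nonneg v)]
  simp only [mul_pow, this]

namespace IsBrownianFamily

variable (hW : IsBrownianFamily F P W)
include hW

theorem hasLaw_increment (k : Fin n) {s t : ℝ≥0} (hst : s ≤ t) :
    HasLaw (fun ω => W k t ω - W k s ω) (gaussianReal 0 (t - s)) P := by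
  have h := (hW.isBrownian k).toIsPreBrownianReal.hasLaw_sub t s
  have h2 : nndist (t : ℝ≥0).1 s.1 = t - s := by
    refine NNReal.coe_injective ?_
    change |(t : ℝ) - s| = ((t - s : ℝ≥0) : ℝ)
    rw [NNReal.coe_sub hst, abs_of_nonneg (sub_nonneg.2 (NNReal.coe_le_coe.2 hst))]
  rwa [h2] at h

theorem memLp_increment (k : Fin n) {s t : ℝ≥0} (hst : s ≤ t) {p : ℝ≥0∞} (hp : p ≠ ∞) :
    MemLp (fun ω => W k t ω - W k s ω) p P := by
  have h := hW.hasLaw_increment k hst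
  have h2 := memLp_id_gaussianReal' (μ := 0) (v := t - s) p hp
  rw [← h.map_eq, memLp_map_measure_iff aestronglyMeasurable_id h.aemeasurable] at h2
  exact h2

theorem integrable_increment_pow_four (k : Fin n) {s t : ℝ≥0} (hst : s ≤ t) :
    Integrable (fun ω => (W k t ω - W k s ω) ^ 4) P := by
  have h := (hW.memLp_increment k hst (p := 4) (by simp)).integrable_norm_pow (p := 4) (by norm_num)
  refine h.congr (ae_of_all _ fun ω => ?_)
  simp only [Real.norm_eq_abs]
  exact Even.pow_abs (by decide) _

theorem integral_increment_pow_four (k : Fin n) {s t : ℝ≥0} (hst : s ≤ t) :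
    ∫ ω, (W k t ω - W k s ω) ^ 4 ∂P = gaussianFourthMoment * (t - s : ℝ) ^ 2 := by
  have h := (hW.hasLaw_increment k hst).integral_comp (f := fun x => x ^ 4) (by fun_prop)
  have h2 := integral_pow_four_gaussianReal (t - s)
  rw [NNReal.coe_sub hst] at h2
  rw [← h2]
  exact h

theorem integral_increment (k : Fin n) {s t : ℝ≥0} (hst : s ≤ t) :
    ∫ ω, (W k t ω - W k s ω) ∂P = 0 := by
  rw [(hW.hasLaw_increment k hst).integral_eq, integral_id_gaussianReal]

theorem integral_increment_sq (k : Fin n) {s t : ℝ≥0} (hst : s ≤ t) :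
    ∫ ω, (W k t ω - W k s ω) ^ 2 ∂P = t - s := by
  have h := (hW.hasLaw_increment k hst).variance_eq
  rw [variance_id_gaussianReal, NNReal.coe_sub hst,
    variance_of_integral_eq_zero (hW.hasLaw_increment k hst).aemeasurable
    (hW.integral_increment k hst)] at h
  exact h

theorem stronglyMeasurable_increment (k : Fin n) {s t : ℝ≥0} (hst : s ≤ t) :
    StronglyMeasurable[F t] (fun ω => W k t ω - W k s ω) :=
  (hW.adapted k t).sub ((hW.adapted k s).mono (F.mono hst))

theorem indep_function_increment {s t : ℝ≥0} (hst : s ≤ t) {g : (Fin n → ℝ) → ℝ}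
    (hg : Measurable g) :
    Indep (F s) (MeasurableSpace.comap (fun ω => g fun k => W k t ω - W k s ω) inferInstance) P := by
  refine indep_of_indep_of_le_right (hW.indep_past s t hst) ?_
  rw [show (fun ω => g fun k => W k t ω - W k s ω) = g ∘ fun ω k => W k t ω - W k s ω from rfl,
    ← MeasurableSpace.comap_comp]
  exact MeasurableSpace.comap_mono hg.comap_le

theorem isNoise_increment (k : Fin n) {s t : ℝ≥0} (hst : s ≤ t) :
    IsNoise F P s t (fun ω => W k t ω - W k s ω) (t - s) where
  measurable := hW.stronglyMeasurable_increment k hst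
  indep := hW.indep_function_increment hst (g := fun x => x k) (measurable_pi_apply k)
  memLp := hW.memLp_increment k hst (by simp)
  mean := hW.integral_increment k hst
  variance_le := (hW.integral_increment_sq k hst).le

theorem indepFun_increment {j k : Fin n} (hjk : j ≠ k) (s t : ℝ≥0) :
    IndepFun (fun ω => W j t ω - W j s ω) (fun ω => W k t ω - W k s ω) P := by
  have hm : Measurable fun x : ℝ≥0 → ℝ => x t - x s :=
    (measurable_pi_apply t).sub (measurable_pi_apply s)
  exact (hW.indep_components.indepFun hjk).comp hm hm

theorem integral_increment_mul (j k : Fin n) {s t : ℝ≥0} (hst : s ≤ t) :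
    ∫ ω, (W j t ω - W j s ω) * (W k t ω - W k s ω) ∂P = if j = k then (t - s : ℝ) else 0 := by
  split_ifs with h
  · subst h
    simp only [← sq, hW.integral_increment_sq j hst]
  · rw [(hW.indepFun_increment h s t).integral_fun_mul_eq_mul_integral
      (hW.memLp_increment j hst (p := 2) (by simp)).aestronglyMeasurable
      (hW.memLp_increment k hst (p := 2) (by simp)).aestronglyMeasurable, hW.integral_increment j hst, zero_mul]

/-- The essential point is the quadratic variance bound: summed over a partition it is at most a
constant times `t` times the mesh. -/
theorem isNoise_increment_mul_sub [IsProbabilityMeasure P] (j k : Fin n) {s t : ℝ≥0} (hst : s ≤ t) :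
    IsNoise F P s t (fun ω => (W j t ω - W j s ω) * (W k t ω - W k s ω) -
      if j = k then (t - s : ℝ) else 0) ((2 * gaussianFourthMoment + 2) * (t - s : ℝ) ^ 2) := by
  set d : ℝ := if j = k then (t - s : ℝ) else 0 with hd
  have hd2 : d ^ 2 ≤ (t - s : ℝ) ^ 2 := by
    rw [hd]; split_ifs
    · exact le_rfl
    · simpa using sq_nonneg _
  have hmeas : StronglyMeasurable[F t]
      (fun ω => (W j t ω - W j s ω) * (W k t ω - W k s ω) - d) :=
    ((hW.stronglyMeasurable_increment j hst).mul (hW.stronglyMeasurable_increment k hst)).sub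
      stronglyMeasurable_const
  -- `(ab - d)² ≤ 2a²b² + 2d²` and `2a²b² ≤ a⁴ + b⁴`; with `d² ≤ (t - s)²` this produces the
  -- constant in the variance bound.
  have hle : ∀ ω, ((W j t ω - W j s ω) * (W k t ω - W k s ω) - d) ^ 2 ≤
      (W j t ω - W j s ω) ^ 4 + (W k t ω - W k s ω) ^ 4 + 2 * d ^ 2 := fun ω => by
    generalize W j t ω - W j s ω = a
    generalize W k t ω - W k s ω = b
    nlinarith [sq_nonneg (a * b + d), sq_nonneg (a ^ 2 - b ^ 2)]
  have hint : Integrable (fun ω => (W j t ω - W j s ω) ^ 4 + (W k t ω - W k s ω) ^ 4 + 2 * d ^ 2)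
      P := ((hW.integrable_increment_pow_four j hst).add
        (hW.integrable_increment_pow_four k hst)).add (integrable_const _)
  have hLp : MemLp (fun ω => (W j t ω - W j s ω) * (W k t ω - W k s ω) - d) 2 P := by
    rw [memLp_two_iff_integrable_sq (hmeas.mono (F.le t)).aestronglyMeasurable]
    refine hint.mono' ((hmeas.mono (F.le t)).pow 2).aestronglyMeasurable (ae_of_all _ fun ω => ?_)
    rw [Real.norm_of_nonneg (sq_nonneg _)]
    exact hle ω
  refine ⟨hmeas, ?_, hLp, ?_, ?_⟩
  · exact hW.indep_function_increment hst (g := fun x => x j * x k - d) (by fun_prop)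
  · have hI : Integrable (fun ω => (W j t ω - W j s ω) * (W k t ω - W k s ω)) P :=
      (hW.memLp_increment j hst (p := 2) (by simp)).integrable_mul (hW.memLp_increment k hst (p := 2) (by simp))
    rw [integral_sub hI (integrable_const _), hW.integral_increment_mul j k hst]
    simp [hd]
  · refine (integral_mono hLp.integrable_sq hint hle).trans ?_
    have hsum : Integrable (fun ω => (W j t ω - W j s ω) ^ 4 + (W k t ω - W k s ω) ^ 4) P :=
      (hW.integrable_increment_pow_four j hst).add (hW.integrable_increment_pow_four k hst)
    rw [integral_add hsum (integrable_const _),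
      integral_add (hW.integrable_increment_pow_four j hst)
        (hW.integrable_increment_pow_four k hst), hW.integral_increment_pow_four j hst,
      hW.integral_increment_pow_four k hst]
    simp only [integral_const, probReal_univ, smul_eq_mul, one_mul]
    linarith

end IsBrownianFamily

end Brownian

theorem tendsto_sum_mul_smul {E : Type*} [NormedAddCommGroup E] [NormedSpace ℝ E]
    {x : ℝ≥0 → E} {u v : ℝ≥0 → ℝ} (hx : Continuous x) (hu : Continuous u)
    (hv : LocallyBoundedVariationOn v Set.univ) (t : ℝ≥0) :
    Tendsto (fun p : TimePartition t => ∑ i ∈ Finset.range p.N,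
      ((u (p.pt (i + 1)) - u (p.pt i)) * (v (p.pt (i + 1)) - v (p.pt i))) • x (p.pt i))
      (meshToZero t) (𝓝 0) := by
  obtain ⟨b, hb⟩ := (isCompact_Icc (a := 0) (b := t)).exists_bound_of_continuousOn hx.continuousOn
  have h := (tendsto_sum_norm_mul_norm hu hv t).mul_const b
  rw [zero_mul] at h
  refine squeeze_zero_norm (fun p => ?_) h
  rw [Finset.sum_mul]
  refine norm_sum_le_of_le _ fun i hi => ?_
  rw [norm_smul, norm_mul]
  exact mul_le_mul_of_nonneg_left
    (hb _ ⟨zero_le, p.pt_le (Finset.mem_range.1 hi).le⟩) (by positivity)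

/-! ### Truncation of coefficients -/

section Truncate

variable {E : Type*} [NormedAddCommGroup E]

open Classical in
/-- The vector `v` if its norm is at most `b`, and zero otherwise. -/
noncomputable def normTruncate (b : ℝ) (v : E) : E := if ‖v‖ ≤ b then v else 0

theorem norm_normTruncate_le {b : ℝ} (hb : 0 ≤ b) (v : E) : ‖normTruncate b v‖ ≤ b := by
  unfold normTruncate
  split_ifs with h
  · exact h
  · simpa using hb

theorem normTruncate_of_le {b : ℝ} {v : E} (h : ‖v‖ ≤ b) : normTruncate b v = v := if_pos h

/-- Truncation uses only the value at the given time, so it preserves adaptedness and takes the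
place of localization by stopping times. -/
theorem stronglyMeasurable_normTruncate {Ω : Type*} {m : MeasurableSpace Ω} {f : Ω → E}
    (hf : StronglyMeasurable f) (b : ℝ) : StronglyMeasurable fun ω => normTruncate b (f ω) :=
  StronglyMeasurable.ite (hf.norm.measurable measurableSet_Iic) hf stronglyMeasurable_const

end Truncate

/-! ### Weighted quadratic covariation of the record -/

section Record

variable {Ω E : Type*} {mΩ : MeasurableSpace Ω} {P : Measure Ω}
  {F : Filtration ℝ≥0 mΩ} {n : ℕ} {W Y : Fin n → ℝ≥0 → Ω → ℝ}

/-- `Y` is adapted and differs from the Brownian motion `W` by continuous processes of locally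
bounded variation. -/
structure IsBrownianWithDrift (F : Filtration ℝ≥0 mΩ) (P : Measure Ω)
    (W Y : Fin n → ℝ≥0 → Ω → ℝ) : Prop where
  brownian : IsBrownianFamily F P W
  adapted : ∀ k, StronglyAdapted F (Y k)
  drift_continuous : ∀ k, ∀ᵐ ω ∂P, Continuous fun t => Y k t ω - W k t ω
  drift_variation : ∀ k, ∀ᵐ ω ∂P,
    LocallyBoundedVariationOn (fun t => Y k t ω - W k t ω) Set.univ

theorem IsHomodyneRecord.exists_isBrownianWithDrift (h : IsHomodyneRecord F P Y) :
    ∃ W : Fin n → ℝ≥0 → Ω → ℝ, IsBrownianWithDrift F P W Y := by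
  obtain ⟨hY, W, a, hW, ha⟩ := h
  refine ⟨W, hW, hY, fun k => ?_, fun k => ?_⟩
  · filter_upwards [ha k] with ω hω
    have := continuous_primitive_nnreal fun t => (hω t).1
    refine this.congr fun t => ?_
    rw [(hω t).2]; ring
  · filter_upwards [ha k] with ω hω
    have := locallyBoundedVariationOn_primitive fun t => (hω t).1
    convert this using 2 with t
    rw [(hω t).2]; ring

namespace IsBrownianWithDrift

variable [NormedAddCommGroup E] [InnerProductSpace ℝ E]
variable (hY : IsBrownianWithDrift F P W Y)
include hY

theorem continuous (k : Fin n) : ∀ᵐ ω ∂P, Continuous fun t => Y k t ω := by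
  filter_upwards [hY.drift_continuous k, (hY.brownian.isBrownian k).cont] with ω h1 h2
  exact (h1.add h2).congr fun t => by simp

theorem measurable (k : Fin n) (t : ℝ≥0) : StronglyMeasurable (Y k t) :=
  (hY.adapted k t).mono (F.le t)

variable [IsProbabilityMeasure P] {X : ℝ≥0 → Ω → E} (hX : StronglyAdapted F X)
  (hXc : ∀ᵐ ω ∂P, Continuous fun t => X t ω)
include hX hXc

/-- The sum is a martingale transform of the compensated products. Where `X` is bounded by `r` on
`[0, t]` it agrees with its truncated version, whose second moment is of the order of the mesh. -/
theorem tendstoInMeasure_martingale_part (j k : Fin n) (t : ℝ≥0) :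
    TendstoInMeasure P (fun (p : TimePartition t) ω => ∑ i ∈ Finset.range p.N,
      ((W j (p.pt (i + 1)) ω - W j (p.pt i) ω) * (W k (p.pt (i + 1)) ω - W k (p.pt i) ω) -
        if j = k then (p.pt (i + 1) - p.pt i : ℝ) else 0) • X (p.pt i) ω)
      (meshToZero t) fun _ => 0 := by
  have hW := hY.brownian
  have hXm : ∀ s, StronglyMeasurable (X s) := fun s => (hX s).mono (F.le s)
  have hWm : ∀ k s, StronglyMeasurable (W k s) := fun k s => (hW.adapted k s).mono (F.le s)
  refine tendstoInMeasure_zero_of_exhaustion (fun p => ?_) fun ε hε η hη => ?_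
  · refine (Finset.stronglyMeasurable_fun_sum _ fun i _ => ?_).aestronglyMeasurable
    exact ((((hWm j _).sub (hWm j _)).mul ((hWm k _).sub (hWm k _))).sub
      stronglyMeasurable_const).smul (hXm _)
  refine ⟨fun r => {ω | ∀ s ≤ t, ‖X s ω‖ ≤ r}, fun r r' hr ω hω s hs =>
    (hω s hs).trans (by exact_mod_cast hr), ?_, fun r => ?_⟩
  · filter_upwards [hXc] with ω hω
    obtain ⟨b, hb⟩ := (isCompact_Icc (a := 0) (b := t)).exists_bound_of_continuousOn
      hω.continuousOn
    obtain ⟨r, hr⟩ := exists_nat_ge b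
    exact ⟨r, fun s hs => (hb s ⟨zero_le, hs⟩).trans hr⟩
  set C : ℝ := 2 * gaussianFourthMoment + 2 with hC
  have hC0 : 0 < C := by have := gaussianFourthMoment_nonneg; positivity
  -- Chebyshev gives probability at most `r² C t · mesh / ε²`, to be made at most `η`; the `+ 1`
  -- keeps the denominator positive when `r` or `t` is zero.
  have hδ : 0 < η * ε ^ 2 / ((r : ℝ) ^ 2 * (C * t) + 1) := by positivity
  filter_upwards [eventually_mesh_lt t hδ] with p hp
  obtain ⟨-, hL, hle⟩ := martingaleTransform_sq_le p.mono (n := p.N)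
    (fun i _ => hW.isNoise_increment_mul_sub j k (p.mono i.le_succ))
    (fun i _ => stronglyMeasurable_normTruncate (hX (p.pt i)) r)
    (fun i _ ω => norm_normTruncate_le r.cast_nonneg _)
  refine ⟨_, (measureReal_le_integral_sq_div hL hε).trans ?_, fun ω hω hB => ?_⟩
  · rw [div_le_iff₀ (by positivity)]
    have hsum : ∑ i ∈ Finset.range p.N, C * (p.pt (i + 1) - p.pt i : ℝ) ^ 2 ≤ C * t * p.mesh := by
      rw [← p.sum_sub, Finset.mul_sum, Finset.sum_mul]
      refine Finset.sum_le_sum fun i hi => ?_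
      rw [sq, mul_assoc]
      have h1 := p.coe_sub_le_mesh (Finset.mem_range.1 hi)
      have h2 := sub_nonneg.2 (p.coe_le_succ i)
      gcongr
    refine hle.trans ((mul_le_mul_of_nonneg_left hsum (sq_nonneg _)).trans ?_)
    rw [lt_div_iff₀ (by positivity)] at hp
    have : (0 : ℝ) ≤ p.mesh := NNReal.coe_nonneg _
    nlinarith
  · have hB' : ¬ ε ≤ _ := hB
    rw [not_le] at hB'
    refine lt_of_eq_of_lt ?_ hB'
    congr 1
    refine Finset.sum_congr rfl fun i hi => ?_
    rw [normTruncate_of_le (hω _ (p.pt_le (Finset.mem_range.1 hi).le))]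

theorem tendstoInMeasure_weighted_covariation [CompleteSpace E] (j k : Fin n) (t : ℝ≥0) :
    TendstoInMeasure P (fun (p : TimePartition t) ω => ∑ i ∈ Finset.range p.N,
      ((Y j (p.pt (i + 1)) ω - Y j (p.pt i) ω) * (Y k (p.pt (i + 1)) ω - Y k (p.pt i) ω)) •
        X (p.pt i) ω) (meshToZero t)
      fun ω => if j = k then ∫ s in (0 : ℝ)..t, X s.toNNReal ω else 0 := by
  have hXm : ∀ s, StronglyMeasurable (X s) := fun s => (hX s).mono (F.le s)
  have hWm : ∀ k s, StronglyMeasurable (W k s) := fun k s =>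
    (hY.brownian.adapted k s).mono (F.le s)
  have hYm := hY.measurable
  have h1 := hY.tendstoInMeasure_martingale_part hX hXc j k t
  have h2 : TendstoInMeasure P (fun (p : TimePartition t) ω => ∑ i ∈ Finset.range p.N,
      ((Y j (p.pt (i + 1)) ω - Y j (p.pt i) ω) * (Y k (p.pt (i + 1)) ω - Y k (p.pt i) ω) -
      ((W j (p.pt (i + 1)) ω - W j (p.pt i) ω) * (W k (p.pt (i + 1)) ω - W k (p.pt i) ω) -
        if j = k then (p.pt (i + 1) - p.pt i : ℝ) else 0)) • X (p.pt i) ω)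
      (meshToZero t) fun ω => if j = k then ∫ s in (0 : ℝ)..t, X s.toNNReal ω else 0 := by
    refine tendstoInMeasure_of_ae_tendsto (fun p => ?_) ?_
    · refine (Finset.stronglyMeasurable_fun_sum _ fun i _ => ?_).aestronglyMeasurable
      exact ((((hYm j _).sub (hYm j _)).mul ((hYm k _).sub (hYm k _))).sub
        ((((hWm j _).sub (hWm j _)).mul ((hWm k _).sub (hWm k _))).sub
        stronglyMeasurable_const)).smul (hXm _)
    · filter_upwards [hXc, hY.continuous k, (hY.brownian.isBrownian j).cont, hY.drift_variation j,
        hY.drift_variation k] with ω hx hy hw hvj hvk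
      have hr : Tendsto (fun p : TimePartition t => ∑ i ∈ Finset.range p.N,
          (if j = k then (p.pt (i + 1) - p.pt i : ℝ) else 0) • X (p.pt i) ω) (meshToZero t)
          (𝓝 (if j = k then ∫ s in (0 : ℝ)..t, X s.toNNReal ω else 0)) := by
        split_ifs
        · exact tendsto_riemannSum hx t
        · simp
      -- `ΔY_j ΔY_k - ΔW_j ΔW_k = ΔY_k Δ(Y_j - W_j) + ΔW_j Δ(Y_k - W_k)`: each term pairs a
      -- continuous path with one of bounded variation.
      have := ((tendsto_sum_mul_smul hx hy hvj t).add (tendsto_sum_mul_smul hx hw hvk t)).add hr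
      rw [zero_add, zero_add] at this
      refine this.congr fun p => ?_
      rw [← Finset.sum_add_distrib, ← Finset.sum_add_distrib]
      refine Finset.sum_congr rfl fun i _ => ?_
      rw [← add_smul, ← add_smul]
      congr 1
      ring
  have h3 := tendstoInMeasure_add h1 h2
  simp only [← Finset.sum_add_distrib, ← add_smul, add_sub_cancel, zero_add] at h3
  exact h3

end IsBrownianWithDrift

end Record

theorem sum_range_mul_eq_sum_sum {M : Type*} [AddCommMonoid M] (f : ℕ → M) (a m : ℕ) :
    ∑ l ∈ Finset.range (a * m), f l =
      ∑ i ∈ Finset.range a, ∑ r ∈ Finset.range m, f (i * m + r) := by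
  induction a with
  | zero => simp
  | succ a ih => rw [Nat.add_mul, one_mul, Finset.sum_range_add, ih, Finset.sum_range_succ]

/-! ### Left sums on a refined partition -/

section Refine

variable {Ω E : Type*} {mΩ : MeasurableSpace Ω} [NormedAddCommGroup E] [NormedSpace ℝ E]

/-- The sum `∑ (X(s) - X(p.pt i)) dY` over the points `s` of the grid with `m + 1` points in the
`i`-th interval of `p`. -/
noncomputable def blockSum {t : ℝ≥0} (p : TimePartition t) (m i : ℕ) (X : ℝ≥0 → E) (Y : ℝ≥0 → ℝ) :
    E :=
  ∑ r ∈ Finset.range (m + 1),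
    (Y (p.gridPt (m + 1) (i * (m + 1) + r + 1)) - Y (p.gridPt (m + 1) (i * (m + 1) + r))) •
      (X (p.gridPt (m + 1) (i * (m + 1) + r)) - X (p.pt i))

/-- The two left sums differ by the terms of the `i`-th interval. Telescoping `Y` over the same grid
points subtracts the frozen value `X (p.pt i)` from each of them. -/
theorem leftSum_refine_succ_sub (X : ℝ≥0 → Ω → E) (Y : ℝ≥0 → Ω → ℝ) {t : ℝ≥0}
    (p : TimePartition t) (m i : ℕ) (ω : Ω) :
    leftSum X Y (p.refine (i + 1) m) ω - leftSum X Y (p.refine i m) ω -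
      (Y (p.pt (i + 1)) ω - Y (p.pt i) ω) • X (p.pt i) ω =
      blockSum p m i (X · ω) (Y · ω) := by
  have h1 : leftSum X Y (p.refine (i + 1) m) ω - leftSum X Y (p.refine i m) ω =
      ∑ r ∈ Finset.range (m + 1),
      (Y (p.gridPt (m + 1) (i * (m + 1) + r + 1)) ω - Y (p.gridPt (m + 1) (i * (m + 1) + r)) ω) •
        X (p.gridPt (m + 1) (i * (m + 1) + r)) ω := by
    change ∑ l ∈ Finset.range ((i + 1) * (m + 1)), _ - ∑ l ∈ Finset.range (i * (m + 1)), _ = _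
    rw [Nat.add_mul i, one_mul, Finset.sum_range_add]
    exact add_sub_cancel_left _ _
  have h2 : Y (p.pt (i + 1)) ω - Y (p.pt i) ω = ∑ r ∈ Finset.range (m + 1),
      (Y (p.gridPt (m + 1) (i * (m + 1) + r + 1)) ω -
        Y (p.gridPt (m + 1) (i * (m + 1) + r)) ω) := by
    have := Finset.sum_range_sub (fun r => Y (p.gridPt (m + 1) (i * (m + 1) + r)) ω) (m + 1)
    simp only [← add_assoc] at this
    rw [this, add_zero, p.gridPt_mul m.succ_pos, add_assoc, ← p.gridPt_mul m.succ_pos (i + 1),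
      Nat.add_mul, one_mul]
  rw [h1, h2, Finset.sum_smul, ← Finset.sum_sub_distrib, blockSum]
  exact Finset.sum_congr rfl fun r _ => (smul_sub _ _ _).symm

theorem sum_norm_blockSum_le {t : ℝ≥0} (p : TimePartition t) (m : ℕ) {X : ℝ≥0 → E}
    {v : ℝ≥0 → ℝ} {V b : ℝ} (hv : VariationLE v t V)
    (hb : ∀ i < p.N, ∀ r ≤ m, ‖X (p.gridPt (m + 1) (i * (m + 1) + r)) - X (p.pt i)‖ ≤ b)
    (hb0 : 0 ≤ b) :
    ∑ i ∈ Finset.range p.N, ‖blockSum p m i X v‖ ≤ b * V := by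
  have h1 := hv _ (p.gridPt_mono (m + 1)) (p.N * (m + 1))
    (by rw [p.gridPt_mul m.succ_pos, p.pt_last])
  rw [sum_range_mul_eq_sum_sum] at h1
  refine le_trans ?_ (mul_le_mul_of_nonneg_left h1 hb0)
  rw [Finset.mul_sum]
  refine Finset.sum_le_sum fun i hi => ?_
  rw [Finset.mul_sum]
  refine norm_sum_le_of_le _ fun r hr => ?_
  rw [norm_smul, mul_comm]
  exact mul_le_mul_of_nonneg_right
    (hb i (Finset.mem_range.1 hi) r (Nat.lt_succ_iff.1 (Finset.mem_range.1 hr))) (norm_nonneg _)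

end Refine

/-! ### First-order approximation of Itô integrals and their covariation -/

section Remainder

variable {Ω E : Type*} {mΩ : MeasurableSpace Ω} {P : Measure Ω} [IsProbabilityMeasure P]
  {F : Filtration ℝ≥0 mΩ} {n : ℕ} {W Y : Fin n → ℝ≥0 → Ω → ℝ}
  [NormedAddCommGroup E] [InnerProductSpace ℝ E] {X : ℝ≥0 → Ω → E}

omit [IsProbabilityMeasure P] in
-- `R i` is the block sum with its coefficients truncated at `η`. Its second moment is at most `η²`
-- times the length of the interval, and these lengths add up to `t`.
theorem IsBrownianFamily.exists_truncated_blockSum (hW : IsBrownianFamily F P W)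
    (hX : StronglyAdapted F X) (k : Fin n) {t : ℝ≥0} (p : TimePartition t) (m : ℕ) {η : ℝ}
    (hη : 0 ≤ η) :
    ∃ R : ℕ → Ω → E, (∀ i, MemLp (R i) 2 P) ∧
      ∑ i ∈ Finset.range p.N, ∫ ω, ‖R i ω‖ ^ 2 ∂P ≤ η ^ 2 * t ∧
      ∀ ω, ∀ i, (∀ r ≤ m, ‖X (p.gridPt (m + 1) (i * (m + 1) + r)) ω - X (p.pt i) ω‖ ≤ η) →
        R i ω = blockSum p m i (X · ω) (W k · ω) := by
  have key := fun i => martingaleTransform_sq_le (P := P)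
    (τ := fun r => p.gridPt (m + 1) (i * (m + 1) + r))
    (fun r r' h => p.gridPt_mono (m + 1) (Nat.add_le_add_left h _)) (n := m + 1)
    (V := fun r ω => normTruncate η (X (p.gridPt (m + 1) (i * (m + 1) + r)) ω - X (p.pt i) ω))
    (fun r _ => hW.isNoise_increment k (p.gridPt_mono (m + 1) (Nat.le_succ _)))
    (fun r hr => stronglyMeasurable_normTruncate ((hX _).sub ((hX _).mono
      (F.mono (p.gridPt_mem m.succ_pos i hr.le).1))) η)
    (fun r _ ω => norm_normTruncate_le hη _)
  refine ⟨_, fun i => (key i).2.1, ?_, fun ω i h => ?_⟩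
  · refine (Finset.sum_le_sum fun i _ => (key i).2.2).trans (le_of_eq ?_)
    rw [← Finset.mul_sum, ← p.sum_sub]
    congr 1
    refine Finset.sum_congr rfl fun i _ => ?_
    have := Finset.sum_range_sub (fun r => (p.gridPt (m + 1) (i * (m + 1) + r) : ℝ)) (m + 1)
    rw [add_zero, p.gridPt_mul m.succ_pos, show i * (m + 1) + (m + 1) = (i + 1) * (m + 1) by ring,
      p.gridPt_mul m.succ_pos] at this
    exact this
  · refine Finset.sum_congr rfl fun r hr => ?_
    rw [normTruncate_of_le (h r (Nat.lt_succ_iff.1 (Finset.mem_range.1 hr)))]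
    rfl

/-- The squared errors of the first-order approximation of an Itô integral tend to zero. -/
theorem IsBrownianWithDrift.tendstoInMeasure_remainder (hY : IsBrownianWithDrift F P W Y)
    (hX : StronglyAdapted F X) (hXc : ∀ᵐ ω ∂P, Continuous fun t => X t ω) (j : Fin n)
    {I : ℝ≥0 → Ω → E} (hI : ∀ t, AEStronglyMeasurable (I t) P)
    (hIlim : ∀ t, TendstoInMeasure P (leftSum X (Y j)) (meshToZero t) (I t)) (t : ℝ≥0) :
    TendstoInMeasure P (fun (p : TimePartition t) ω => ∑ i ∈ Finset.range p.N,
      ‖I (p.pt (i + 1)) ω - I (p.pt i) ω - (Y j (p.pt (i + 1)) ω - Y j (p.pt i) ω) • X (p.pt i) ω‖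
        ^ 2) (meshToZero t) fun _ => 0 := by
  have hXm : ∀ s, StronglyMeasurable (X s) := fun s => (hX s).mono (F.le s)
  have hYm := hY.measurable
  refine tendstoInMeasure_zero_of_exhaustion (fun p => ?_) fun ε hε θ hθ => ?_
  · refine Finset.aestronglyMeasurable_fun_sum _ fun i _ => ?_
    exact (((hI _).sub (hI _)).sub
      (((hYm j _).sub (hYm j _)).smul (hXm _)).aestronglyMeasurable).norm.pow 2
  -- The first bound on `η` absorbs the drift blocks, the second is Markov's inequality for the
  -- Brownian blocks at level `ε / 12`.
  obtain ⟨η, hη, hη1, hη2⟩ : ∃ η : ℝ, 0 < η ∧ 3 * η ^ 2 ≤ ε / 4 ∧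
      η ^ 2 * t / (ε / 12) ≤ θ / 2 := by
    have hc : 0 < min (ε / 12) (θ * ε / (24 * (t + 1))) := by positivity
    refine ⟨√(min (ε / 12) (θ * ε / (24 * (t + 1)))), Real.sqrt_pos.2 hc, ?_, ?_⟩
    · rw [Real.sq_sqrt hc.le]
      have := min_le_left (ε / 12) (θ * ε / (24 * (t + 1)))
      linarith
    · rw [Real.sq_sqrt hc.le, div_le_iff₀ (by positivity)]
      have h1 := min_le_right (ε / 12) (θ * ε / (24 * (t + 1)))
      have h2 : θ * ε / (24 * (t + 1)) * (t + 1 : ℝ) = θ * ε / 24 := by field_simp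
      have h3 := mul_le_mul_of_nonneg_right h1 t.2
      have h4 : 0 ≤ θ * ε / (24 * (t + 1)) := by positivity
      nlinarith
  -- The variation bound `V` may depend on `ω`. The factor `1 + V` makes both the oscillation of `X`
  -- and its product with `V` at most `η`.
  refine ⟨fun r => {ω | ∃ V, VariationLE (fun s => Y j s ω - W j s ω) t V ∧
    ∀ s ≤ t, ∀ s' ≤ t, dist s s' < 1 / ((r : ℝ) + 1) → ‖X s ω - X s' ω‖ * (1 + V) ≤ η}, ?_, ?_, ?_⟩
  · rintro r r' hr ω ⟨V, hV, h⟩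
    refine ⟨V, hV, fun s hs s' hs' hd => h s hs s' hs' (hd.trans_le ?_)⟩
    have : (r : ℝ) ≤ r' := by exact_mod_cast hr
    gcongr
  · filter_upwards [hXc, hY.drift_variation j] with ω hx hv
    obtain ⟨V, hV⟩ := hv.exists_variationLE t
    have hV0 := hV.nonneg
    obtain ⟨δ, hδ, h⟩ := exists_uniform_modulus hx t (ε := η / (1 + V)) (by positivity)
    obtain ⟨r, hr⟩ := exists_nat_one_div_lt hδ
    refine ⟨r, V, hV, fun s hs s' hs' hd => ?_⟩
    rw [← le_div_iff₀ (by positivity)]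
    exact (h s hs s' hs' (hd.trans hr)).le
  intro r
  filter_upwards [eventually_mesh_lt t (δ := 1 / ((r : ℝ) + 1)) (by positivity)] with p hp
  -- Now `p` is fixed, so `δ`, and then `m`, may depend on its number of intervals.
  obtain ⟨δ, hδ, hδN⟩ : ∃ δ : ℝ, 0 < δ ∧ 12 * p.N * δ ^ 2 ≤ ε / 4 := by
    have hc : 0 < ε / (48 * ((p.N : ℝ) + 1)) := by positivity
    refine ⟨√(ε / (48 * ((p.N : ℝ) + 1))), Real.sqrt_pos.2 hc, ?_⟩
    rw [Real.sq_sqrt hc.le, mul_div_assoc', div_le_div_iff₀ (by positivity) (by norm_num)]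
    nlinarith
  obtain ⟨m, hm⟩ : ∃ m : ℕ, ∀ i ∈ Finset.range (p.N + 1),
      P.real {ω | δ ≤ ‖leftSum X (Y j) (p.refine i m) ω - I (p.pt i) ω‖} <
        θ / (2 * (p.N + 1)) := by
    refine Eventually.exists (f := atTop) ?_
    rw [eventually_all_finset]
    intro i _
    have h := tendstoInMeasure_iff_measureReal_norm.1
      ((hIlim (p.pt i)).comp (p.tendsto_refine i)) δ hδ
    exact h.eventually (gt_mem_nhds (by positivity))
  obtain ⟨R, hRL, hRle, hReq⟩ := hY.brownian.exists_truncated_blockSum hX j p m hη.le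
  -- `B1` collects large Brownian blocks; `B2` collects poor approximation of `I` by refined left
  -- sums at some point of `p`.
  set B1 := {ω | ε / 12 ≤ ∑ i ∈ Finset.range p.N, ‖R i ω‖ ^ 2} with hB1
  set B2 := ⋃ i ∈ Finset.range (p.N + 1),
    {ω | δ ≤ ‖leftSum X (Y j) (p.refine i m) ω - I (p.pt i) ω‖} with hB2
  refine ⟨B1 ∪ B2, ?_, ?_⟩
  · have h1 : P.real B1 ≤ θ / 2 := by
      refine le_trans ?_ hη2
      have h := mul_meas_ge_le_integral_of_nonneg (μ := P)
        (f := fun ω => ∑ i ∈ Finset.range p.N, ‖R i ω‖ ^ 2)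
        (ae_of_all _ fun ω => Finset.sum_nonneg fun _ _ => sq_nonneg _)
        (integrable_finsetSum _ fun i _ => (hRL i).norm.integrable_sq) (ε / 12)
      rw [integral_finsetSum _ fun i _ => (hRL i).norm.integrable_sq] at h
      rw [le_div_iff₀ (by positivity), mul_comm]
      exact h.trans hRle
    have h2 : P.real B2 ≤ θ / 2 := by
      refine (measureReal_biUnion_finset_le _ _).trans ?_
      refine (Finset.sum_le_sum fun i hi => (hm i hi).le).trans (le_of_eq ?_)
      rw [Finset.sum_const, Finset.card_range, nsmul_eq_mul]
      push_cast
      field_simp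
    exact (measureReal_union_le _ _).trans (by linarith)
  · rintro ω ⟨V, hV, hosc⟩ hB
    simp only [Set.mem_union, not_or] at hB
    obtain ⟨hb1, hb2⟩ := hB
    have hb1' : ∑ i ∈ Finset.range p.N, ‖R i ω‖ ^ 2 < ε / 12 := not_le.1 hb1
    have hb2' : ∀ i ≤ p.N, ‖leftSum X (Y j) (p.refine i m) ω - I (p.pt i) ω‖ < δ := by
      intro i hi
      by_contra hcon
      exact hb2 (Set.mem_biUnion (Finset.mem_coe.2 (Finset.mem_range.2 (Nat.lt_succ_iff.2 hi)))
        (not_lt.1 hcon))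
    have hV0 := hV.nonneg
    have hbd : ∀ i < p.N, ∀ q ≤ m,
        ‖X (p.gridPt (m + 1) (i * (m + 1) + q)) ω - X (p.pt i) ω‖ ≤ η / (1 + V) := by
      intro i hi q hq
      have hmem := p.gridPt_mem m.succ_pos i (r := q) (by omega)
      rw [le_div_iff₀ (by positivity)]
      exact hosc _ (hmem.2.trans (p.pt_le hi)) _ (p.pt_le hi.le)
        ((p.dist_le_mesh hi hmem ⟨le_rfl, p.mono i.le_succ⟩).trans_lt hp)
    have hηV : η / (1 + V) ≤ η := div_le_self hη.le (by linarith)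
    have hA := sum_norm_blockSum_le p m (X := (X · ω)) hV hbd (by positivity)
    have hAη : η / (1 + V) * V ≤ η := by
      rw [div_mul_eq_mul_div, div_le_iff₀ (by positivity)]; nlinarith
    set D : ℕ → E := fun i => blockSum p m i (X · ω) (fun s => Y j s ω - W j s ω) with hD
    have hA2 : ∑ i ∈ Finset.range p.N, ‖D i‖ ^ 2 ≤ η ^ 2 := by
      refine (Finset.sum_sq_le_sq_sum_of_nonneg fun i _ => norm_nonneg _).trans ?_
      have := hA.trans hAη
      have h0 : 0 ≤ ∑ i ∈ Finset.range p.N, ‖D i‖ := Finset.sum_nonneg fun _ _ => norm_nonneg _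
      gcongr
    -- From `(a + b + 2δ)² ≤ 3a² + 3b² + 12δ²`; after summation each of the three terms is at most
    -- `ε / 4`.
    have hterm : ∀ i ∈ Finset.range p.N,
        ‖I (p.pt (i + 1)) ω - I (p.pt i) ω -
          (Y j (p.pt (i + 1)) ω - Y j (p.pt i) ω) • X (p.pt i) ω‖ ^ 2 ≤
          3 * ‖R i ω‖ ^ 2 + 3 * ‖D i‖ ^ 2 + 12 * δ ^ 2 := by
      intro i hi
      have hi' := Finset.mem_range.1 hi
      have hL := leftSum_refine_succ_sub X (Y j) p m i ω
      have hRi := hReq ω i fun q hq => (hbd i hi' q hq).trans hηV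
      have hsplit : blockSum p m i (X · ω) (Y j · ω) = R i ω + D i := by
        simp only [hRi, hD, blockSum]
        rw [← Finset.sum_add_distrib]
        refine Finset.sum_congr rfl fun q _ => ?_
        rw [← add_smul]
        congr 1
        ring
      have heq : I (p.pt (i + 1)) ω - I (p.pt i) ω -
          (Y j (p.pt (i + 1)) ω - Y j (p.pt i) ω) • X (p.pt i) ω =
          R i ω + D i - (leftSum X (Y j) (p.refine (i + 1) m) ω - I (p.pt (i + 1)) ω) +
            (leftSum X (Y j) (p.refine i m) ω - I (p.pt i) ω) := by
        rw [← hsplit, ← hL]; abel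
      have h1 := hb2' (i + 1) hi'
      have h2 := hb2' i hi'.le
      rw [heq]
      have h3 := norm_add_le (R i ω + D i -
        (leftSum X (Y j) (p.refine (i + 1) m) ω - I (p.pt (i + 1)) ω))
        (leftSum X (Y j) (p.refine i m) ω - I (p.pt i) ω)
      have h4 := norm_sub_le (R i ω + D i)
        (leftSum X (Y j) (p.refine (i + 1) m) ω - I (p.pt (i + 1)) ω)
      have h5 := norm_add_le (R i ω) (D i)
      have h6 : ‖R i ω + D i - (leftSum X (Y j) (p.refine (i + 1) m) ω - I (p.pt (i + 1)) ω) +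
            (leftSum X (Y j) (p.refine i m) ω - I (p.pt i) ω)‖ ≤ ‖R i ω‖ + ‖D i‖ + 2 * δ := by
        linarith
      refine (pow_le_pow_left₀ (norm_nonneg _) h6 2).trans ?_
      nlinarith [sq_nonneg (‖R i ω‖ - ‖D i‖), sq_nonneg (‖R i ω‖ - 2 * δ),
        sq_nonneg (‖D i‖ - 2 * δ)]
    rw [Real.norm_of_nonneg (Finset.sum_nonneg fun _ _ => sq_nonneg _)]
    refine (Finset.sum_le_sum hterm).trans_lt ?_
    rw [Finset.sum_add_distrib, Finset.sum_add_distrib, ← Finset.mul_sum, ← Finset.mul_sum,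
      Finset.sum_const, Finset.card_range, nsmul_eq_mul]
    nlinarith

/-- The covariation of an Itô integral against `Y j` with `Y k`. -/
theorem IsBrownianWithDrift.tendstoInMeasure_crossSum_itoIntegral [CompleteSpace E]
    (hY : IsBrownianWithDrift F P W Y)
    (hX : StronglyAdapted F X) (hXc : ∀ᵐ ω ∂P, Continuous fun t => X t ω) (j k : Fin n)
    {I : ℝ≥0 → Ω → E} (hI : ∀ t, AEStronglyMeasurable (I t) P)
    (hIlim : ∀ t, TendstoInMeasure P (leftSum X (Y j)) (meshToZero t) (I t)) (t : ℝ≥0) :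
    TendstoInMeasure P (crossSum I (Y k)) (meshToZero t)
      fun ω => if j = k then ∫ s in (0 : ℝ)..t, X s.toNNReal ω else 0 := by
  -- With constant weight `1` this is `∑ (ΔY_k) ^ 2 → t`, the bounded factor in Cauchy–Schwarz.
  have hQ := hY.tendstoInMeasure_weighted_covariation (X := fun _ _ => (1 : ℝ))
    (fun _ => stronglyMeasurable_const) (ae_of_all _ fun _ => continuous_const) k k t
  have h1 : TendstoInMeasure P (fun (p : TimePartition t) ω => ∑ i ∈ Finset.range p.N,
      (Y k (p.pt (i + 1)) ω - Y k (p.pt i) ω) • (I (p.pt (i + 1)) ω - I (p.pt i) ω -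
        (Y j (p.pt (i + 1)) ω - Y j (p.pt i) ω) • X (p.pt i) ω)) (meshToZero t) fun _ => 0 := by
    refine tendstoInMeasure_zero_of_sq_norm_le (c := t)
      (g := fun p ω => ∑ i ∈ Finset.range p.N, (Y k (p.pt (i + 1)) ω - Y k (p.pt i) ω) ^ 2)
      (hY.tendstoInMeasure_remainder hX hXc j hI hIlim t) ?_
      (fun p ω => Finset.sum_nonneg fun _ _ => sq_nonneg _) fun p ω => ?_
    · simpa [← sq] using hQ
    · have hn : ‖∑ i ∈ Finset.range p.N,
          (Y k (p.pt (i + 1)) ω - Y k (p.pt i) ω) • (I (p.pt (i + 1)) ω - I (p.pt i) ω -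
          (Y j (p.pt (i + 1)) ω - Y j (p.pt i) ω) • X (p.pt i) ω)‖ ≤ _ := norm_sum_le _ _
      refine (pow_le_pow_left₀ (norm_nonneg _) hn 2).trans ?_
      simp only [norm_smul]
      refine (Finset.sum_mul_sq_le_sq_mul_sq _ _ _).trans (le_of_eq ?_)
      simp only [Real.norm_eq_abs, sq_abs]
      rw [mul_comm]
  have h2 := tendstoInMeasure_add h1 (hY.tendstoInMeasure_weighted_covariation hX hXc j k t)
  simp only [zero_add] at h2
  refine h2.congr_left fun p => ae_of_all _ fun ω => ?_
  rw [crossSum, ← Finset.sum_add_distrib]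
  refine Finset.sum_congr rfl fun i _ => ?_
  rw [smul_sub, smul_smul, mul_comm (Y k _ _ - _), sub_add_cancel]

end Remainder

/-! ### Covariations of solutions and the Itô correction -/

section Solutions

variable {Ω E : Type*} {mΩ : MeasurableSpace Ω} {P : Measure Ω}

/-- `IsItoIntegral` does not ask for measurability; the integral inherits it from the left sums. -/
theorem aestronglyMeasurable_of_leftSum_limit [NormedAddCommGroup E] [NormedSpace ℝ E]
    {X I : ℝ≥0 → Ω → E} {Y : ℝ≥0 → Ω → ℝ} (hX : ∀ t, StronglyMeasurable (X t))
    (hY : ∀ t, StronglyMeasurable (Y t)) {t : ℝ≥0}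
    (hI : TendstoInMeasure P (leftSum X Y) (meshToZero t) (I t)) :
    AEStronglyMeasurable (I t) P := by
  refine hI.aestronglyMeasurable fun p => ?_
  exact (Finset.stronglyMeasurable_fun_sum _ fun i _ =>
    ((hY _).sub (hY _)).smul (hX _)).aestronglyMeasurable

/-- A countable dense set of times needs only one null set, and continuity extends the equality to
all times. -/
theorem ae_forall_eq_of_continuous [TopologicalSpace E] [T2Space E] {f g : ℝ≥0 → Ω → E}
    (hf : ∀ᵐ ω ∂P, Continuous fun t => f t ω) (hg : ∀ᵐ ω ∂P, Continuous fun t => g t ω)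
    (h : ∀ t, ∀ᵐ ω ∂P, f t ω = g t ω) : ∀ᵐ ω ∂P, ∀ t, f t ω = g t ω := by
  obtain ⟨D, hDc, hD⟩ := TopologicalSpace.exists_countable_dense ℝ≥0
  filter_upwards [hf, hg, (ae_ball_iff hDc).2 fun t _ => h t] with ω h1 h2 h3
  exact congrFun (Continuous.ext_on hD h1 h2 h3)

variable [IsProbabilityMeasure P] {F : Filtration ℝ≥0 mΩ} {n : ℕ} {W Y : Fin n → ℝ≥0 → Ω → ℝ}

/-- The covariation with `Y k` of a process that is a sum of Itô integrals against the `Y j`, up to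
a process of locally bounded variation. -/
theorem IsBrownianWithDrift.tendstoInMeasure_crossSum [NormedAddCommGroup E] [InnerProductSpace ℝ E]
    [CompleteSpace E] (hY : IsBrownianWithDrift F P W Y) {X I : Fin n → ℝ≥0 → Ω → E}
    {χ : ℝ≥0 → Ω → E} (hX : ∀ j, StronglyAdapted F (X j))
    (hXc : ∀ j, ∀ᵐ ω ∂P, Continuous fun t => X j t ω) (hχ : StronglyAdapted F χ)
    (hI : ∀ j, IsItoIntegral P (X j) (Y j) (I j))
    (hZ : ∀ᵐ ω ∂P, LocallyBoundedVariationOn (fun t => χ t ω - ∑ j, I j t ω) Set.univ)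
    (k : Fin n) (t : ℝ≥0) :
    TendstoInMeasure P (crossSum χ (Y k)) (meshToZero t)
      fun ω => ∫ s in (0 : ℝ)..t, X k s.toNNReal ω := by
  have hIm : ∀ j t, AEStronglyMeasurable (I j t) P := fun j t =>
    aestronglyMeasurable_of_leftSum_limit (fun s => (hX j s).mono (F.le s)) (hY.measurable j)
      ((hI j).tendsto t)
  have h1 : TendstoInMeasure P (crossSum (fun t ω => χ t ω - ∑ j, I j t ω) (Y k)) (meshToZero t)
      fun _ => 0 := by
    refine tendstoInMeasure_of_ae_tendsto (fun p => ?_) ?_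
    · have hm : ∀ s, AEStronglyMeasurable (fun ω => χ s ω - ∑ j, I j s ω) P := fun s =>
        ((hχ s).mono (F.le s)).aestronglyMeasurable.sub
          (Finset.aestronglyMeasurable_fun_sum _ fun j _ => hIm j s)
      exact Finset.aestronglyMeasurable_fun_sum _ fun i _ =>
        (((hY.measurable k _).sub (hY.measurable k _)).aestronglyMeasurable).smul
          ((hm _).sub (hm _))
    · filter_upwards [hZ, hY.continuous k] with ω hz hy
      refine squeeze_zero_norm (fun p => ?_) (tendsto_sum_norm_mul_norm hy hz t)
      exact norm_sum_le_of_le _ fun i _ => (norm_smul _ _).le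
  have h2 := tendstoInMeasure_finset_sum Finset.univ fun j _ =>
    hY.tendstoInMeasure_crossSum_itoIntegral (hX j) (hXc j) j k (hIm j) (hI j).tendsto t
  have h3 := tendstoInMeasure_add h1 h2
  simp only [Finset.sum_ite_eq', Finset.mem_univ, if_true, zero_add] at h3
  refine h3.congr_left fun p => ae_of_all _ fun ω => ?_
  simp only [crossSum]
  rw [Finset.sum_comm, ← Finset.sum_add_distrib]
  refine Finset.sum_congr rfl fun i _ => ?_
  rw [← Finset.smul_sum, ← smul_add, Finset.sum_sub_distrib]
  congr 1
  abel

namespace OpenSystem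

variable {𝔥 : Type*} [NormedAddCommGroup 𝔥] [InnerProductSpace ℂ 𝔥] [CompleteSpace 𝔥]

omit [CompleteSpace 𝔥] in
theorem crossSum_map (T : 𝔥 →L[ℂ] 𝔥) (χ : ℝ≥0 → Ω → 𝔥) (y : ℝ≥0 → Ω → ℝ) {t : ℝ≥0}
    (p : TimePartition t) (ω : Ω) :
    crossSum (fun t ω => T (χ t ω)) y p ω = T (crossSum χ y p ω) := by
  simp only [crossSum, map_sum, ← map_sub]
  exact Finset.sum_congr rfl fun i _ => ((T.restrictScalars ℝ).map_smul _ _).symm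

/-- The algebraic core: squaring the phase `e^{iθ_k}` gives `e^{2iθ_k}`, so the two drifts differ by
half the sum of the `M_k ^ 2`. -/
theorem K_apply (G : OpenSystem n 𝔥) (θ : Fin n → ℝ) (v : 𝔥) :
    G.K v = G.KΘ θ v + (1 / 2 : ℝ) • ∑ k, G.M θ k (G.M θ k v) := by
  have e : ∀ k, Complex.exp (2 * Complex.I * (θ k : ℂ)) =
      Complex.exp (Complex.I * (θ k : ℂ)) * Complex.exp (Complex.I * (θ k : ℂ)) := fun k => by
    rw [← Complex.exp_add]; ring_nf
  have h : ∀ w : 𝔥, (1 / 2 : ℝ) • w = (1 / 2 : ℂ) • w := fun w => by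
    rw [← Complex.coe_smul]; norm_num
  simp only [K, KΘ, M, h, e, _root_.sub_apply, _root_.neg_apply,
    _root_.smul_apply, _root_.sum_apply, _root_.add_apply,
    mul_apply_eq_comp, Finset.sum_add_distrib, map_smul, smul_smul]
  module

omit [CompleteSpace 𝔥] in
theorem continuous_apply_toNNReal (T : 𝔥 →L[ℂ] 𝔥) {x : ℝ≥0 → 𝔥} (hx : Continuous x) :
    Continuous fun s : ℝ => T (x s.toNNReal) :=
  T.continuous.comp (hx.comp continuous_real_toNNReal)

theorem integral_K (G : OpenSystem n 𝔥) (θ : Fin n → ℝ) {x : ℝ≥0 → 𝔥} (hx : Continuous x)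
    (t : ℝ≥0) :
    ∫ s in (0 : ℝ)..t, G.K (x s.toNNReal) = (∫ s in (0 : ℝ)..t, G.KΘ θ (x s.toNNReal)) +
      ∑ k, (1 / 2 : ℝ) • ∫ s in (0 : ℝ)..t, G.M θ k (G.M θ k (x s.toNNReal)) := by
  have hM : ∀ k, Continuous fun s : ℝ => G.M θ k (G.M θ k (x s.toNNReal)) := fun k =>
    (G.M θ k).continuous.comp (continuous_apply_toNNReal _ hx)
  simp only [K_apply G θ]
  have hsum : Continuous fun s : ℝ => (1 / 2 : ℝ) • ∑ k, G.M θ k (G.M θ k (x s.toNNReal)) :=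
    (continuous_finsetSum _ fun k _ => hM k).const_smul _
  rw [intervalIntegral.integral_add
    ((continuous_apply_toNNReal _ hx).intervalIntegrable _ _) (hsum.intervalIntegrable _ _),
    intervalIntegral.integral_smul, intervalIntegral.integral_finsetSum
    fun k _ => (hM k).intervalIntegrable _ _, Finset.smul_sum]

/-- The covariation `[M_k χ, Y_k]` for a process `χ` driven by the `M_k χ dY_k`. -/
theorem isCovariation_M (G : OpenSystem n 𝔥) (θ : Fin n → ℝ)
    (hY : IsBrownianWithDrift F P W Y) {χ : ℝ≥0 → Ω → 𝔥} (hχ : StronglyAdapted F χ)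
    (hχc : ∀ᵐ ω ∂P, Continuous fun t => χ t ω) {I : Fin n → ℝ≥0 → Ω → 𝔥}
    (hI : ∀ k, IsItoIntegral P (fun t ω => G.M θ k (χ t ω)) (Y k) (I k))
    (hZ : ∀ᵐ ω ∂P, LocallyBoundedVariationOn (fun t => χ t ω - ∑ j, I j t ω) Set.univ)
    (k : Fin n) :
    IsCovariation P (fun t ω => G.M θ k (χ t ω)) (Y k)
      (fun t ω => ∫ s in (0 : ℝ)..t, G.M θ k (G.M θ k (χ s.toNNReal ω))) := by
  -- The second-moment estimates use a real inner product, here the real part of the complex one.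
  let _ : InnerProductSpace ℝ 𝔥 := InnerProductSpace.complexToReal
  have hM : ∀ j, StronglyAdapted F fun t ω => G.M θ j (χ t ω) := fun j t =>
    (G.M θ j).continuous.comp_stronglyMeasurable (hχ t)
  have hMc : ∀ j, ∀ᵐ ω ∂P, Continuous fun t => G.M θ j (χ t ω) := fun j => by
    filter_upwards [hχc] with ω h using (G.M θ j).continuous.comp h
  refine ⟨?_, ?_, fun t => ?_⟩
  · filter_upwards [hMc k] with ω h
    exact continuous_primitive_nnreal fun t =>
      (continuous_apply_toNNReal _ h).intervalIntegrable _ _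
  · filter_upwards [hMc k] with ω h
    exact locallyBoundedVariationOn_primitive fun t =>
      (continuous_apply_toNNReal _ h).intervalIntegrable _ _
  · have h1 := tendstoInMeasure_map_continuousLinear (G.M θ k)
      (hY.tendstoInMeasure_crossSum hM hMc hχ hI hZ k t)
    refine h1.congr (fun p => ae_of_all _ fun ω => (crossSum_map _ _ _ _ _).symm) ?_
    filter_upwards [hMc k] with ω h
    exact ((G.M θ k).intervalIntegral_comp_comm
      ((h.comp continuous_real_toNNReal).intervalIntegrable _ _)).symm

end OpenSystem

end Solutions

theorem proposition3 {n : ℕ} {𝔥 : Type*} [NormedAddCommGroup 𝔥] [InnerProductSpace ℂ 𝔥]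
    [CompleteSpace 𝔥] (G : OpenSystem n 𝔥) (θ : Fin n → ℝ)
    {Ω : Type*} {mΩ : MeasurableSpace Ω} (P : Measure Ω) [IsProbabilityMeasure P]
    (F : Filtration ℝ≥0 mΩ) (Y : Fin n → ℝ≥0 → Ω → ℝ) (hY : IsHomodyneRecord F P Y)
    (ψ : 𝔥) (χ : ℝ≥0 → Ω → 𝔥) :
    G.IsItoSolution θ F P Y ψ χ ↔ G.IsStratonovichSolution θ F P Y ψ χ := by
  obtain ⟨W, hW⟩ := hY.exists_isBrownianWithDrift
  constructor
  · rintro ⟨hχ, hχc, I, hI, heq⟩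
    have hC := G.isCovariation_M θ hW hχ hχc hI (by
      filter_upwards [hχc, heq] with ω hc h
      have := (locallyBoundedVariationOn_const_path ψ).add_path
        (locallyBoundedVariationOn_primitive fun t =>
          (OpenSystem.continuous_apply_toNNReal G.K hc).intervalIntegrable _ _)
      convert this using 2 with t
      rw [h t, add_sub_cancel_right])
    refine ⟨hχ, hχc, _, fun k => ⟨I k, _, hI k, hC k, ae_of_all _ fun ω t => rfl⟩, ?_⟩
    filter_upwards [hχc, heq] with ω hc h t
    rw [h t, G.integral_K θ hc, Finset.sum_add_distrib]
    abel
  · rintro ⟨hχ, hχc, S, hS, heq⟩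
    choose I C hI hC hSIC using hS
    -- Here `χ - ∑ I` contains the unknown `½ ∑ C k`; the bounded variation required of `C k` lets
    -- the covariation be computed without knowing `C k`.
    have hC' := G.isCovariation_M θ hW hχ hχc hI (by
      filter_upwards [hχc, heq, ae_all_iff.2 hSIC, ae_all_iff.2 fun k => (hC k).boundedVariation]
        with ω hc h hs hv
      have := ((locallyBoundedVariationOn_const_path ψ).add_path
        (locallyBoundedVariationOn_primitive fun t =>
          (OpenSystem.continuous_apply_toNNReal (G.KΘ θ) hc).intervalIntegrable _ _)).add_path
        (LocallyBoundedVariationOn.sum_path Finset.univ fun k => (hv k).const_smul_path (1 / 2 : ℝ))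
      convert this using 2 with t
      rw [h t]
      simp only [hs, Finset.sum_add_distrib]
      abel)
    -- Both processes are limits in probability of the same cross sums, hence equal at each time,
    -- and by continuity at all times.
    have hCeq : ∀ k, ∀ᵐ ω ∂P, ∀ t, C k t ω = _ := fun k =>
      ae_forall_eq_of_continuous (hC k).continuous (hC' k).continuous fun t =>
        tendstoInMeasure_ae_unique ((hC k).tendsto t) ((hC' k).tendsto t)
    refine ⟨hχ, hχc, I, hI, ?_⟩
    filter_upwards [hχc, heq, ae_all_iff.2 hSIC, ae_all_iff.2 hCeq] with ω hc h hs hce t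
    rw [h t, G.integral_K θ hc]
    simp only [hs, hce, Finset.sum_add_distrib]
    abel
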